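/- **Theorem (Frenet–Serret formulae for KP coordinates and Zakharov–Shabat equations).** Let $\mathbb k,\mathbb K\in\{\mathbb R,\mathbb C\}$ with $\mathbb K$ a $\mathbb k$-algebra, let $n\ge 0$ and $N\ge\max(n,1)$ (the basic case is $N=n$), and let $[z]=(z^{(0)},\dots,z^{(N)})$, $[\bar z]=(\bar z^{(0)},\dots,\bar z^{(N)})$ be independent $\mathbb k$-variables, $\partial_p=\partial/\partial z^{(p)}$, $\bar\partial_p=\partial/\partial\bar z^{(p)}$. Let $\mathbf f=(f^0,\dots,f^n)$ and $\bar{\mathbf f}=(\bar f^0,\dots,\bar f^n)$ be smooth $\mathbb K^{n+1}$-valued functions of $[z]\in U$ and of $[\bar z]\in\bar U$ respectively ($U,\bar U$ open), with $$\partial_p\mathbf f=\partial_1^{\,p}\mathbf f,\qquad \bar\partial_p\bar{\mathbf f}=\bar\partial_1^{\,p}\bar{\mathbf f}\qquad(0\le p\le N),$$ extending the chiral embedding functions $\mathbf f(z)$, $\bar{\mathbf f}(\bar z)$ of a W-surface, which are recovered where $z^{(k)}=0$, resp. $\bar z^{(k)}=0$, for all $k\neq1$. Put $\eta_{i\bar\jmath}=\sum_A\partial_if^A\,\bar\partial_j\bar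 f^A$, and let $\tilde v_\ell$ (resp. $\bar v_\ell$) be the determinant with rows $(\eta_{0\bar r},\dots,\eta_{\ell\bar r})$ (resp. $(\eta_{r\bar0},\dots,\eta_{r\bar\ell})$), $0\le r<\ell$, and last row $(\partial_0\mathbf f,\dots,\partial_\ell\mathbf f)$ (resp. $(\bar\partial_0\bar{\mathbf f},\dots,\bar\partial_\ell\bar{\mathbf f})$). Let $\psi_s,\psi_s^+$ ($s\ge 0$) be free fermions, $[\psi_s,\psi_t^+]_+=\delta_{st}$, $[\psi_s,\psi_t]_+=[\psi^+_s,\psi^+_t]_+=0$, $\psi_s|\emptyset\rangle=0=\langle\emptyset|\psi_s^+$, $|\ell\rangle=\psi^+_{\ell-1}\cdots\psi^+_0|\emptyset\rangle$, $\langle\ell|=\langle\emptyset|\psi_0\cdots\psi_{\ell-1}$, $J_p=\sum_{s\ge0}\psi^+_{p+s}\psi_s$, $\bar J_p=\sum_{s\ge0}\psi^+_s\psi_{p+s}$. With $\psi_{f^A}=\sum_s(\partial_1^sf^A)\psi_s$ and $\psi^+_{\bar f^A}=\sum_s(\bar\partial_1^s\bar f^A)\psi^+_s$, the embedding operator is $$\mathcal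 G([z],[\bar z])=\sum_{a=0}^{n+1}\ \sum_{0\le A_1<\dots<A_a\le n}\psi^+_{\bar f^{A_1}}\cdots\psi^+_{\bar f^{A_a}}|\emptyset\rangle\langle\emptyset|\psi_{f^{A_a}}\cdots\psi_{f^{A_1}},$$ and $\tau_\ell=\langle\ell|\mathcal G|\ell\rangle$. For $p\ge0$ and $0\le\ell,m\le n$ let $$(F^p)_{\ell m}=\frac1{\tau_m\tau_{m+1}}\sum_{s\ge0}\langle m+1|\mathcal G\psi^+_{s+p}|m\rangle\langle\ell|\mathcal G\psi_s|\ell+1\rangle,\qquad (G^p)_{m\ell}=\frac1{\tau_m\tau_{m+1}}\sum_{s\ge0}\langle\ell+1|\psi^+_s\mathcal G|\ell\rangle\langle m|\psi_{s+p}\mathcal G|m+1\rangle ,$$ and put $\tilde u_\ell=\tilde v_\ell/\tau_\ell$, $\bar u_\ell=\bar v_\ell/\tau_{\ell+1}$. Then at every point of $U\times\bar U$ where $\tau_\ell\ne0$ for all $0\le\ell\le n+1$, the following hold. 1. $\partial_p\mathcal G=\mathcal GJ_p$ and $\bar\partial_p\mathcal G=\bar J_p\mathcal G$ for $0\le p\le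 N$, in all matrix elements between finite-particle states. 2. $(\bar u_\ell,\tilde u_m)=\sum_A\bar u_\ell^A\tilde u_m^A=\delta_{\ell m}$ for $0\le\ell,m\le n$. 3. For $0\le p\le N$ and $0\le\ell\le n$ (sums over indices $m$ with $0\le m\le n$ only), $$\partial_p\tilde u_\ell=\sum_{m=\ell}^{\ell+p}\tau_\ell^{-1}(F^p)_{\ell m}\tau_m\,\tilde u_m,\qquad \bar\partial_p\tilde u_\ell=-\sum_{m=\ell-p}^{\ell-1}\tau_{\ell+1}(G^p)_{\ell m}\tau_{m+1}^{-1}\,\tilde u_m,$$ $$\bar\partial_p\bar u_\ell=\sum_{m=\ell+1}^{\ell+p}\bar u_m\,\tau_{m+1}(G^p)_{m\ell}\tau_{\ell+1}^{-1},\qquad \partial_p\bar u_\ell=-\sum_{m=\ell-p}^{\ell}\bar u_m\,\tau_m^{-1}(F^p)_{m\ell}\tau_\ell .$$ 4. For all $p\ge 0$ and $0\le\ell,m\le n$, $F^p$ and $G^p$ are the matrix elements of the $p$-th powers of $J_1$ and $\bar J_1$ between the states $|v_\ell\rangle=\sum_{s\le\ell}\langle\ell|\mathcal G\psi_s|\ell+1\rangle\psi_s^+|\emptyset\rangle$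 and $\langle\bar v_\ell|=\sum_{s\le\ell}\langle\ell+1|\psi_s^+\mathcal G|\ell\rangle\langle\emptyset|\psi_s$: $$(F^p)_{\ell m}=\frac{\langle\bar v_m|\mathcal G(J_1)^p|v_\ell\rangle}{\tau_m\tau_{m+1}},\qquad (G^p)_{m\ell}=\frac{\langle\bar v_\ell|(\bar J_1)^p\mathcal G|v_m\rangle}{\tau_m\tau_{m+1}}.$$ Moreover, if $\ell+p\le n+1$, then $(F^p)_{\ell m}$ and $(G^p)_{m\ell}$ are the $(\ell,m)$ and $(m,\ell)$ entries of the $p$-th powers of the $(n+1)\times(n+1)$ matrices $F=F^1$ and $G=G^1$. 5. Let $\chi_s([\partial])=\sum_{i_1+2i_2+\dots+si_s=s}\prod_{\alpha=1}^s\frac1{i_\alpha!}\bigl(\frac1\alpha\partial_\alpha\bigr)^{i_\alpha}$. For all $p\ge0$ and $0\le\ell,m\le n$ with $\ell-m+p\le N$ (in particular for all entries occurring in 3), $$(F^p)_{\ell m}=\frac1{\tau_m\tau_{m+1}}\sum_{s=0}^{\ell-m+p}\bigl(\chi_s([\partial])\tau_{m+1}\bigr)\bigl(\chi_{\ell-m+p-s}(-[\partial])\tau_\ell\bigr),$$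 and $(G^p)_{m\ell}$ is given by the same expression with $[\bar\partial]$ in place of $[\partial]$ (an empty sum is $0$). 6. With $H_1=\mathrm{diag}(\tau_\ell)$, $H_2=\mathrm{diag}(\tau_{\ell+1})$ ($0\le\ell\le n$), $M^+$ the upper triangular part of $M$ with its diagonal and $M^-$ the strictly lower triangular part, set $\nabla_p=\partial_p-H_1^{-1}(F^p)^+H_1$ and $\bar\nabla_p=\bar\partial_p+H_2(G^p)^-H_2^{-1}$. For $0\le p,q\le N$ the integrability conditions of the linear systems $\nabla_pw=0$, $\bar\nabla_pw=0$ hold, and they are the Zakharov–Shabat equations $$[\nabla_p,\bar\nabla_q]=0,\qquad[\nabla_p,\nabla_q]=0,\qquad[\bar\nabla_p,\bar\nabla_q]=0$$ of the $A_n$ Toda hierarchy: each commutator, applied to a smooth vector function, is multiplication by the matrix $Z=(D_2M_1+M_1M_2)-(D_1M_2+M_2M_1)$, where the pair of equations is written $D_1w=M_1w$, $D_2w=M_2w$, and $Z=0$. -/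

import Mathlib

open scoped ContDiff

namespace WGeom

noncomputable section

/-! ### Free fermions `ψ_s`, `ψ⁺_s` (`s = 0, 1, 2, …`) with a no-particle vacuum -/

/-- The space of finite-particle kets, generated from the no-particle state `|∅⟩ = 1` by the `ψ⁺_s`:
the exterior algebra on the modes `s = 0, 1, 2, …`. -/
abbrev KetSpace (K : Type*) [Field K] : Type _ := ExteriorAlgebra K (ℕ →₀ K)

/-- The space of finite-particle bras, generated from `⟨∅| = 1` by the right action of the `ψ_s`;
`ι e_{i₁} * ⋯ * ι e_{iₐ}` is `⟨∅| ψ_{i₁} ⋯ ψ_{iₐ}`. -/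
abbrev BraSpace (K : Type*) [Field K] : Type _ := ExteriorAlgebra K (ℕ →₀ K)

section Fock

variable {K : Type*} [Field K]

/-- The linear form `e_s ↦ c s` on modes. -/
def modeForm (c : ℕ → K) : Module.Dual K (ℕ →₀ K) := Finsupp.linearCombination K c

/-- `ψ⁺_s` on kets. -/
def create (s : ℕ) (k : KetSpace K) : KetSpace K :=
  ExteriorAlgebra.ι K (Finsupp.single s 1) * k

/-- `∑_s c_s ψ_s` on kets (a finite sum on each ket); contraction kills `|∅⟩` and satisfies
the canonical anticommutation relations with `create`. -/
def annihSum (c : ℕ → K) (k : KetSpace K) : KetSpace K :=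
  CliffordAlgebra.contractLeft (modeForm c) k

/-- `ψ_s` on kets. -/
def annih (s : ℕ) (k : KetSpace K) : KetSpace K := annihSum (Pi.single s 1) k

/-- The right action of `ψ_s` on bras, `⟨b| ↦ ⟨b| ψ_s`. -/
def braAnnih (b : BraSpace K) (s : ℕ) : BraSpace K :=
  b * ExteriorAlgebra.ι K (Finsupp.single s 1)

/-- The right action of `∑_s c_s ψ⁺_s` on bras. -/
def braCreateSum (b : BraSpace K) (c : ℕ → K) : BraSpace K :=
  CliffordAlgebra.contractRight b (modeForm c)

/-- The right action of `ψ⁺_s` on bras, `⟨b| ↦ ⟨b| ψ⁺_s`. -/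
def braCreate (b : BraSpace K) (s : ℕ) : BraSpace K := braCreateSum b (Pi.single s 1)

/-- The component along the no-particle state, `k ↦ ⟨∅|k⟩`, and likewise `b ↦ ⟨b|∅⟩`. -/
def vac (k : ExteriorAlgebra K (ℕ →₀ K)) : K := ExteriorAlgebra.algebraMapInv k

/-- `|m⟩ = ψ⁺_{m-1} ⋯ ψ⁺_0 |∅⟩`. -/
def ket (K : Type*) [Field K] : ℕ → KetSpace K
  | 0 => 1
  | m + 1 => create m (ket K m)

/-- `⟨m| = ⟨∅| ψ_0 ⋯ ψ_{m-1}`. -/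
def bra (K : Type*) [Field K] : ℕ → BraSpace K
  | 0 => 1
  | m + 1 => braAnnih (bra K m) m

/-- The current `J_p = ∑_s ψ⁺_{p+s} ψ_s` on kets (finitely many terms act nontrivially
on a given ket). -/
def current (p : ℕ) (k : KetSpace K) : KetSpace K := ∑ᶠ s : ℕ, create (p + s) (annih s k)

/-- The right action on bras of the current `J̄_p = ∑_s ψ⁺_s ψ_{p+s}`. -/
def braCurrent (p : ℕ) (b : BraSpace K) : BraSpace K :=
  ∑ᶠ s : ℕ, braAnnih (braCreate b s) (p + s)

/-- Matrix elements `⟨b| 𝒢 |k⟩` of the embedding operator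
`𝒢 = ∑_a ∑_{A₁ < ⋯ < Aₐ} ψ⁺_{f̄^{A₁}} ⋯ ψ⁺_{f̄^{Aₐ}} |∅⟩⟨∅| ψ_{f^{Aₐ}} ⋯ ψ_{f^{A₁}}`, where
`ψ_{f^A} = ∑_s (c A s) ψ_s` and `ψ⁺_{f̄^A} = ∑_s (cbar A s) ψ⁺_s`. -/
def embeddingForm {n : ℕ} (c cbar : Fin (n + 1) → ℕ → K) (b : BraSpace K) (k : KetSpace K) : K :=
  ∑ S : Finset (Fin (n + 1)),
    vac ((S.sort (· ≤ ·)).foldl (fun b' A => braCreateSum b' (cbar A)) b) *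
      vac ((S.sort (· ≤ ·)).foldl (fun k' A => annihSum (c A) k') k)

end Fock

/-! ### Schur polynomials in commuting partial derivatives -/

/-- `χ_s(ε [∂]) g = ∑_{i₁ + 2 i₂ + ⋯ + s i_s = s} ∏_α (1 / i_α!) ((ε / α) ∂_α)^{i_α} g`,
where `D α` is the partial derivative `∂_α`. The entry `i j` is the exponent for `α = j + 1`. -/
def schurOp {K X : Type*} [Field K] (D : ℕ → (X → K) → (X → K)) (ε : K) (s : ℕ) (g : X → K)
    (x : X) : K :=
  ∑ i ∈ (Fintype.piFinset fun _ : Fin s => Finset.range (s + 1)).filter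
      (fun i => ∑ j : Fin s, ((j : ℕ) + 1) * i j = s),
    (∏ j : Fin s, ((Nat.factorial (i j) : K))⁻¹ * (ε / (((j : ℕ) + 1 : ℕ) : K)) ^ (i j)) *
      ((List.finRange s).foldr (fun (j : Fin s) h => (D ((j : ℕ) + 1))^[i j] h) g) x

/-! ### W-parametrizations -/

section Param

variable {𝕜 : Type*} [RCLike 𝕜] {K : Type*} [RCLike K] [NormedAlgebra 𝕜 K] {n N : ℕ}

/-- The space of one chirality of KP coordinates `[z] = (z⁽⁰⁾, …, z⁽ᴺ⁾)`. -/
abbrev Times (𝕜 : Type*) (N : ℕ) : Type _ := Fin (N + 1) → 𝕜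

/-- The coordinate direction of `z⁽ᵖ⁾` (used for `p ≤ N`). -/
def dir (𝕜 : Type*) [RCLike 𝕜] (N p : ℕ) : Times 𝕜 N := fun j => if (j : ℕ) = p then 1 else 0

/-- The partial derivative with respect to `z⁽ᵖ⁾` of a function of `[z]` alone. -/
def cd (p : ℕ) {V : Type*} [NormedAddCommGroup V] [NormedSpace 𝕜 V] (g : Times 𝕜 N → V) :
    Times 𝕜 N → V :=
  fun z => lineDeriv 𝕜 g z (dir 𝕜 N p)

/-- The direction of `z⁽ᵖ⁾` in the space of all coordinates `([z], [z̄])`. -/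
def dirZ (𝕜 : Type*) [RCLike 𝕜] (N p : ℕ) : Times 𝕜 N × Times 𝕜 N := (dir 𝕜 N p, 0)

/-- The direction of `z̄⁽ᵖ⁾` in the space of all coordinates `([z], [z̄])`. -/
def dirZbar (𝕜 : Type*) [RCLike 𝕜] (N p : ℕ) : Times 𝕜 N × Times 𝕜 N := (0, dir 𝕜 N p)

/-- The derivative along the constant direction `v`. -/
def D (v : Times 𝕜 N × Times 𝕜 N) {V : Type*} [NormedAddCommGroup V] [NormedSpace 𝕜 V]
    (g : Times 𝕜 N × Times 𝕜 N → V) : Times 𝕜 N × Times 𝕜 N → V :=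
  fun x => lineDeriv 𝕜 g x v

/-- `f` is, on the open set `U`, the extension to KP coordinates of the chiral embedding functions
`f₀` of one variable: `∂f/∂z⁽ᵖ⁾ = ∂ᵖf/∂zᵖ` with `z = z⁽¹⁾`, and `f = f₀` where all `z⁽ᵏ⁾`, `k ≠ 1`,
vanish. -/
structure IsWParam (f₀ : 𝕜 → Fin (n + 1) → K) (U : Set (Times 𝕜 N))
    (f : Times 𝕜 N → Fin (n + 1) → K) : Prop where
  isOpen : IsOpen U
  smooth : ContDiffOn 𝕜 ∞ f U
  flow : ∀ p ≤ N, ∀ z ∈ U, cd p f z = (cd 1)^[p] f z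
  init : ∀ t : 𝕜, t • dir 𝕜 N 1 ∈ U → f (t • dir 𝕜 N 1) = f₀ t

/-- The derivatives `∂ˢ f^A / ∂zˢ` at `[z]`, i.e. the Taylor data of the embedding function. -/
def taylor (f : Times 𝕜 N → Fin (n + 1) → K) (z : Times 𝕜 N) (A : Fin (n + 1)) (s : ℕ) : K :=
  (cd 1)^[s] f z A

variable (f fb : Times 𝕜 N → Fin (n + 1) → K)

/-- `⟨b| 𝒢([z],[z̄]) |k⟩`. -/
def G (x : Times 𝕜 N × Times 𝕜 N) (b : BraSpace K) (k : KetSpace K) : K :=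
  embeddingForm (taylor f x.1) (taylor fb x.2) b k

/-- `τ_ℓ = ⟨ℓ| 𝒢 |ℓ⟩`. -/
def tau (l : ℕ) (x : Times 𝕜 N × Times 𝕜 N) : K := G f fb x (bra K l) (ket K l)

/-- `η_{i j̄} = ∑_A ∂_i f^A ∂̄_j f̄^A`. -/
def eta (i j : ℕ) (x : Times 𝕜 N × Times 𝕜 N) : K :=
  ∑ A, cd i f x.1 A * cd j fb x.2 A

/-- The vector `ṽ_ℓ`: the determinant with rows `(η_{0 r̄}, …, η_{ℓ r̄})`, `r < ℓ`, and last row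
`(∂_0 f, …, ∂_ℓ f)`. -/
def v (l : ℕ) (x : Times 𝕜 N × Times 𝕜 N) (A : Fin (n + 1)) : K :=
  Matrix.det (Matrix.of fun r c : Fin (l + 1) =>
    if (r : ℕ) < l then eta f fb c r x else cd c f x.1 A)

/-- The vector `v̄_ℓ`: the determinant with rows `(η_{r 0̄}, …, η_{r ℓ̄})`, `r < ℓ`, and last row
`(∂̄_0 f̄, …, ∂̄_ℓ f̄)`. -/
def vb (l : ℕ) (x : Times 𝕜 N × Times 𝕜 N) (A : Fin (n + 1)) : K :=
  Matrix.det (Matrix.of fun r c : Fin (l + 1) =>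
    if (r : ℕ) < l then eta f fb r c x else cd c fb x.2 A)

/-- `ũ_ℓ = ṽ_ℓ / τ_ℓ`. -/
def u (l : ℕ) (x : Times 𝕜 N × Times 𝕜 N) : Fin (n + 1) → K :=
  (tau f fb l x)⁻¹ • v f fb l x

/-- `ū_ℓ = v̄_ℓ / τ_{ℓ+1}`. -/
def ub (l : ℕ) (x : Times 𝕜 N × Times 𝕜 N) : Fin (n + 1) → K :=
  (tau f fb (l + 1) x)⁻¹ • vb f fb l x

/-- `(F^p)_{ℓ m} = (τ_m τ_{m+1})⁻¹ ∑_s ⟨m+1| 𝒢 ψ⁺_{s+p} |m⟩ ⟨ℓ| 𝒢 ψ_s |ℓ+1⟩`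
(the terms with `s > ℓ` vanish). -/
def Fmat (p : ℕ) (x : Times 𝕜 N × Times 𝕜 N) (l m : ℕ) : K :=
  (tau f fb m x * tau f fb (m + 1) x)⁻¹ *
    ∑ᶠ s : ℕ, G f fb x (bra K (m + 1)) (create (s + p) (ket K m)) *
      G f fb x (bra K l) (annih s (ket K (l + 1)))

/-- `(G^p)_{m ℓ} = (τ_m τ_{m+1})⁻¹ ∑_s ⟨ℓ+1| ψ⁺_s 𝒢 |ℓ⟩ ⟨m| ψ_{s+p} 𝒢 |m+1⟩`
(the terms with `s > ℓ` vanish). -/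
def Gmat (p : ℕ) (x : Times 𝕜 N × Times 𝕜 N) (m l : ℕ) : K :=
  (tau f fb m x * tau f fb (m + 1) x)⁻¹ *
    ∑ᶠ s : ℕ, G f fb x (braCreate (bra K (l + 1)) s) (ket K l) *
      G f fb x (braAnnih (bra K m) (s + p)) (ket K (m + 1))

/-- `F^p` as an `(n+1) × (n+1)` matrix. -/
def Fm (p : ℕ) (x : Times 𝕜 N × Times 𝕜 N) : Matrix (Fin (n + 1)) (Fin (n + 1)) K :=
  Matrix.of fun i j => Fmat f fb p x i j

/-- `G^p` as an `(n+1) × (n+1)` matrix. -/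
def Gm (p : ℕ) (x : Times 𝕜 N × Times 𝕜 N) : Matrix (Fin (n + 1)) (Fin (n + 1)) K :=
  Matrix.of fun i j => Gmat f fb p x i j

/-- The one-particle ket `∑_{s ≤ ℓ} ⟨ℓ| 𝒢 ψ_s |ℓ+1⟩ ψ⁺_s |∅⟩` representing `ṽ_ℓ`. -/
def ketV (l : ℕ) (x : Times 𝕜 N × Times 𝕜 N) : KetSpace K :=
  ∑ s ∈ Finset.range (l + 1),
    G f fb x (bra K l) (annih s (ket K (l + 1))) • create s (ket K 0)

/-- The one-particle bra `∑_{s ≤ ℓ} ⟨ℓ+1| ψ⁺_s 𝒢 |ℓ⟩ ⟨∅| ψ_s` representing `v̄_ℓ`. -/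
def braV (l : ℕ) (x : Times 𝕜 N × Times 𝕜 N) : BraSpace K :=
  ∑ s ∈ Finset.range (l + 1),
    G f fb x (braCreate (bra K (l + 1)) s) (ket K l) • braAnnih (bra K 0) s

/-- The upper triangular part `M⁺`, diagonal included. -/
def upper (M : Matrix (Fin (n + 1)) (Fin (n + 1)) K) : Matrix (Fin (n + 1)) (Fin (n + 1)) K :=
  Matrix.of fun i j => if i ≤ j then M i j else 0

/-- The strictly lower triangular part `M⁻`. -/
def lower (M : Matrix (Fin (n + 1)) (Fin (n + 1)) K) : Matrix (Fin (n + 1)) (Fin (n + 1)) K :=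
  Matrix.of fun i j => if j < i then M i j else 0

/-- `H₁⁻¹ (F^p)⁺ H₁` with `H₁ = diag(τ_ℓ)`. -/
def laxZ (p : ℕ) (x : Times 𝕜 N × Times 𝕜 N) : Matrix (Fin (n + 1)) (Fin (n + 1)) K :=
  Matrix.diagonal (fun i : Fin (n + 1) => (tau f fb i x)⁻¹) * upper (Fm f fb p x) *
    Matrix.diagonal (fun i : Fin (n + 1) => tau f fb i x)

/-- `- H₂ (G^p)⁻ H₂⁻¹` with `H₂ = diag(τ_{ℓ+1})`. -/
def laxZbar (p : ℕ) (x : Times 𝕜 N × Times 𝕜 N) : Matrix (Fin (n + 1)) (Fin (n + 1)) K :=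
  - (Matrix.diagonal (fun i : Fin (n + 1) => tau f fb (i + 1) x) * lower (Gm f fb p x) *
    Matrix.diagonal (fun i : Fin (n + 1) => (tau f fb (i + 1) x)⁻¹))

end Param

/-! ### Linear systems `D_d w = M w`, their integrability conditions, and Zakharov–Shabat -/

section Systems

variable {𝕜 : Type*} [RCLike 𝕜] {K : Type*} [RCLike K] [NormedAlgebra 𝕜 K] {n N : ℕ}

/-- The operator `φ ↦ D_d φ - M φ` on vector functions. -/
def nabla (d : Times 𝕜 N × Times 𝕜 N)
    (M : Times 𝕜 N × Times 𝕜 N → Matrix (Fin (n + 1)) (Fin (n + 1)) K)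
    (φ : Times 𝕜 N × Times 𝕜 N → Fin (n + 1) → K) : Times 𝕜 N × Times 𝕜 N → Fin (n + 1) → K :=
  fun x => D d φ x - (M x).mulVec (φ x)

/-- The entrywise derivative of a matrix function. -/
def matD (d : Times 𝕜 N × Times 𝕜 N)
    (M : Times 𝕜 N × Times 𝕜 N → Matrix (Fin (n + 1)) (Fin (n + 1)) K)
    (x : Times 𝕜 N × Times 𝕜 N) : Matrix (Fin (n + 1)) (Fin (n + 1)) K :=
  Matrix.of fun i j => D d (fun y => M y i j) x

/-- The matrix `Z` for which a solution `w` of `D_{d₁} w = M₁ w`, `D_{d₂} w = M₂ w` has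
`(D_{d₂} D_{d₁} - D_{d₁} D_{d₂}) w = Z w`. The integrability condition of the pair of equations
is `Z = 0`. -/
def integrabilityDefect (d₁ : Times 𝕜 N × Times 𝕜 N)
    (M₁ : Times 𝕜 N × Times 𝕜 N → Matrix (Fin (n + 1)) (Fin (n + 1)) K)
    (d₂ : Times 𝕜 N × Times 𝕜 N)
    (M₂ : Times 𝕜 N × Times 𝕜 N → Matrix (Fin (n + 1)) (Fin (n + 1)) K)
    (x : Times 𝕜 N × Times 𝕜 N) : Matrix (Fin (n + 1)) (Fin (n + 1)) K :=
  (matD d₂ M₁ x + M₁ x * M₂ x) - (matD d₁ M₂ x + M₂ x * M₁ x)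

/-- The commutator `[D_{d₁} - M₁, D_{d₂} - M₂] φ`. -/
def zsCommutator (d₁ : Times 𝕜 N × Times 𝕜 N)
    (M₁ : Times 𝕜 N × Times 𝕜 N → Matrix (Fin (n + 1)) (Fin (n + 1)) K)
    (d₂ : Times 𝕜 N × Times 𝕜 N)
    (M₂ : Times 𝕜 N × Times 𝕜 N → Matrix (Fin (n + 1)) (Fin (n + 1)) K)
    (φ : Times 𝕜 N × Times 𝕜 N → Fin (n + 1) → K) (x : Times 𝕜 N × Times 𝕜 N) :
    Fin (n + 1) → K :=
  nabla d₁ M₁ (nabla d₂ M₂ φ) x - nabla d₂ M₂ (nabla d₁ M₁ φ) x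

/-- At `x`, the integrability condition of the pair `D_{d₁} w = M₁ w`, `D_{d₂} w = M₂ w` holds, and
it is the Zakharov–Shabat equation `[D_{d₁} - M₁, D_{d₂} - M₂] = 0`: the commutator is the operator
of multiplication by the integrability defect, and it annihilates every smooth vector function. -/
def ZakharovShabat (d₁ : Times 𝕜 N × Times 𝕜 N)
    (M₁ : Times 𝕜 N × Times 𝕜 N → Matrix (Fin (n + 1)) (Fin (n + 1)) K)
    (d₂ : Times 𝕜 N × Times 𝕜 N)
    (M₂ : Times 𝕜 N × Times 𝕜 N → Matrix (Fin (n + 1)) (Fin (n + 1)) K)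
    (x : Times 𝕜 N × Times 𝕜 N) : Prop :=
  (∀ φ : Times 𝕜 N × Times 𝕜 N → Fin (n + 1) → K, ContDiffAt 𝕜 ∞ φ x →
    zsCommutator d₁ M₁ d₂ M₂ φ x = (integrabilityDefect d₁ M₁ d₂ M₂ x).mulVec (φ x)) ∧
  integrabilityDefect d₁ M₁ d₂ M₂ x = 0 ∧
  (∀ φ : Times 𝕜 N × Times 𝕜 N → Fin (n + 1) → K, ContDiffAt 𝕜 ∞ φ x →
    zsCommutator d₁ M₁ d₂ M₂ φ x = 0)

end Systems

end

end WGeom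

/-!
The embedding operator `𝒢` intertwines fermions with fermions: `𝒢 ψ⁺_t = ψ⁺_{η(t, ·)} 𝒢` and
`ψ_t 𝒢 = 𝒢 ψ_{η(·, t)}`, where `η(i, j) = ∑_A c_A(i) c̄_A(j)` are the moments of the Taylor data
(`embeddingForm_create`, `embeddingForm_braAnnih`). Together with `𝒢 |∅⟩ = |∅⟩` this determines all
matrix elements from the moments. Since `∂_p η(i, j) = η(i + p, j)` and the current `J_p` is the
derivation extending `e_t ↦ e_{t+p}`, it gives `∂_p 𝒢 = 𝒢 J_p` (`hasLineDerivAt_G`). The barred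
statements follow from the unbarred ones because reversal of the exterior algebra exchanges bras
with kets, and hence the two chiralities (`embeddingForm_swap`).

The matrix elements `⟨ℓ| 𝒢 ψ_s |ℓ+1⟩` are the coefficients of polynomials `P_ℓ(X)`, and those of the
other chirality are the coefficients of polynomials `Q_ℓ(Y)`; they are biorthogonal for the
functional `X^i Y^j ↦ η(i, j)`, with norms `τ_ℓ τ_{ℓ+1}` (`polyPair_of_lt`, `polyPair_self`).
Expanding determinants along the last row, `ṽ_ℓ = P_ℓ(∂) f` and `v̄_ℓ = Q_ℓ(∂̄) f̄`
(`frame_eq_det`), so that `ũ` and `ū` are dual bases, and `F^p` is the matrix of multiplication by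
`X^p` in the basis `P_ℓ`, exact in the rows that the truncation to degree at most `n` does not
reach (`shiftCoef_eq_pow`).

For the linear systems, `∂_p ũ_ℓ` is expanded in the basis `ũ_m`. The polynomial `P_ℓ / τ_ℓ` is
monic, so the derivatives of its coefficients do not contribute to `m ≥ ℓ`; the components with
`m < ℓ` are found by differentiating orthogonality relations (`hasLineDerivAt_u_aux`). The equations
for `ū` are the dual ones. The Zakharov–Shabat equations follow since the commutator of the two
operators is multiplication by a matrix which annihilates the invertible frame
(`zakharovShabat_of_frame`).

For the Schur polynomials, `∑_s z^s χ_s([∂]) τ` is the matrix element of `𝒢 exp (∑_k z^k J_k / k)`.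
On exterior products this exponential acts multiplicatively through `e_i ↦ ∑_a z^a e_{i+a}`, its
inverse through `e_i ↦ e_i - z e_{i+1}`; on `|m+1⟩` and `|ℓ⟩` only `ψ⁺_{m+s} |m⟩` and
`ψ_{ℓ-s} |ℓ+1⟩` survive (`schurKet_one_modes`, `schurKet_neg_modes`), which are the states
in the definition of `F^p`. That both descriptions of the exponential agree is checked through the
recursion `s χ_s = ±∑_k J_k χ_{s-k}` (`sum_current_eq_schurKet`).
-/

namespace WGeom

noncomputable section

open Filter Topology Finset.HasAntidiagonal

/-! ### The Fock space: creation, annihilation and the currents -/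

section FockSpace

variable {K : Type*} [Field K]

theorem create_zero (s : ℕ) : create s (0 : KetSpace K) = 0 := mul_zero _

theorem create_add (s : ℕ) (k k' : KetSpace K) : create s (k + k') = create s k + create s k' :=
  mul_add _ _ _

theorem create_smul (s : ℕ) (a : K) (k : KetSpace K) : create s (a • k) = a • create s k :=
  mul_smul_comm _ _ _

theorem create_neg (s : ℕ) (k : KetSpace K) : create s (-k) = -create s k := mul_neg _ _

theorem create_sum {ι : Type*} (T : Finset ι) (s : ℕ) (k : ι → KetSpace K) :
    create s (∑ i ∈ T, k i) = ∑ i ∈ T, create s (k i) := Finset.mul_sum _ _ _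

theorem create_create (s t : ℕ) (k : KetSpace K) :
    create s (create t k) = -create t (create s k) := by
  have h := ExteriorAlgebra.ι_add_mul_swap (R := K) (Finsupp.single s (1 : K)) (Finsupp.single t 1)
  simp only [create, ← mul_assoc]
  rw [eq_neg_of_add_eq_zero_left h, neg_mul]

theorem create_create_self (s : ℕ) (k : KetSpace K) : create s (create s k) = 0 := by
  simp only [create, ← mul_assoc, ExteriorAlgebra.ι_sq_zero, zero_mul]

theorem modeForm_single (c : ℕ → K) (s : ℕ) : modeForm c (Finsupp.single s 1) = c s := by
  simp [modeForm]

theorem modeForm_add (c d : ℕ → K) : modeForm (c + d) = modeForm c + modeForm d := by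
  ext; simp [modeForm]

theorem modeForm_smul (a : K) (c : ℕ → K) : modeForm (a • c) = a • modeForm c := by
  ext; simp [modeForm]

theorem annihSum_create (c : ℕ → K) (t : ℕ) (k : KetSpace K) :
    annihSum c (create t k) = c t • k - create t (annihSum c k) := by
  rw [annihSum, create, create, annihSum, CliffordAlgebra.contractLeft_ι_mul, modeForm_single]

theorem annihSum_one (c : ℕ → K) : annihSum c (1 : KetSpace K) = 0 :=
  CliffordAlgebra.contractLeft_one _ (modeForm c)

theorem annihSum_add (c : ℕ → K) (k k' : KetSpace K) :
    annihSum c (k + k') = annihSum c k + annihSum c k' := map_add _ _ _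

theorem annihSum_smul (c : ℕ → K) (a : K) (k : KetSpace K) :
    annihSum c (a • k) = a • annihSum c k := map_smul _ _ _

theorem annihSum_add_left (c d : ℕ → K) (k : KetSpace K) :
    annihSum (c + d) k = annihSum c k + annihSum d k := by
  simp [annihSum, modeForm_add]

theorem annihSum_smul_left (a : K) (c : ℕ → K) (k : KetSpace K) :
    annihSum (a • c) k = a • annihSum c k := by
  simp [annihSum, modeForm_smul]

theorem annihSum_sum_left {ι : Type*} (T : Finset ι) (c : ι → ℕ → K) (k : KetSpace K) :
    annihSum (∑ i ∈ T, c i) k = ∑ i ∈ T, annihSum (c i) k := by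
  classical
  induction T using Finset.induction_on with
  | empty =>
    have := annihSum_smul_left (0 : K) 0 k
    simpa using this
  | insert i T hi ih => rw [Finset.sum_insert hi, Finset.sum_insert hi, annihSum_add_left, ih]

/-- Every ket is a linear combination of kets obtained from `|∅⟩` by creation operators. -/
theorem ket_induction {P : KetSpace K → Prop} (one : P 1)
    (add : ∀ k k', P k → P k' → P (k + k')) (smul : ∀ (a : K) k, P k → P (a • k))
    (create : ∀ t k, P k → P (create t k)) (k : KetSpace K) : P k := by
  induction k using CliffordAlgebra.left_induction with
  | algebraMap r => rw [Algebra.algebraMap_eq_smul_one]; exact smul r 1 one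
  | add k k' h h' => exact add k k' h h'
  | ι_mul k m h =>
    induction m using Finsupp.induction_linear with
    | zero => simpa using smul 0 1 one
    | add a b ha hb => rw [map_add, add_mul]; exact add _ _ ha hb
    | single t a =>
      have : Finsupp.single t a = a • Finsupp.single t (1 : K) := by simp
      rw [this, map_smul, smul_mul_assoc]
      exact smul a _ (create t k h)

/-- A given ket contains only finitely many modes, and `∑_s c_s ψ_s` depends only on the
coefficients of these. -/
theorem annihSum_eq_zero_of_forall_mem (k : KetSpace K) :
    ∃ T : Finset ℕ, ∀ c : ℕ → K, (∀ s ∈ T, c s = 0) → annihSum c k = 0 := by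
  classical
  induction k using ket_induction with
  | one => exact ⟨∅, fun c _ => annihSum_one c⟩
  | add k k' h h' =>
    obtain ⟨T, hT⟩ := h
    obtain ⟨T', hT'⟩ := h'
    refine ⟨T ∪ T', fun c hc => ?_⟩
    rw [annihSum_add, hT c fun s hs => hc s (Finset.mem_union_left _ hs),
      hT' c fun s hs => hc s (Finset.mem_union_right _ hs), add_zero]
  | smul a k h =>
    obtain ⟨T, hT⟩ := h
    exact ⟨T, fun c hc => by rw [annihSum_smul, hT c hc, smul_zero]⟩
  | create t k h =>
    obtain ⟨T, hT⟩ := h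
    refine ⟨insert t T, fun c hc => ?_⟩
    rw [annihSum_create, hc t (Finset.mem_insert_self _ _),
      hT c fun s hs => hc s (Finset.mem_insert_of_mem hs), create_zero, zero_smul, sub_zero]

/-- Only finitely many modes of a given ket can be annihilated. -/
theorem exists_annihSum_eq (k : KetSpace K) :
    ∃ T : Finset ℕ, (∀ s ∉ T, annih s k = 0) ∧
      ∀ c : ℕ → K, annihSum c k = ∑ s ∈ T, c s • annih s k := by
  classical
  obtain ⟨T, hT⟩ := annihSum_eq_zero_of_forall_mem k
  refine ⟨T, fun s hs => hT _ fun t ht => ?_, fun c => ?_⟩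
  · rw [Pi.single_eq_of_ne]
    rintro rfl
    exact hs ht
  · have h := hT (c + (-1 : K) • ∑ s ∈ T, c s • Pi.single s (1 : K)) fun t ht => by
      have : ∑ s ∈ T, (c s • Pi.single s (1 : K) : ℕ → K) t = c t := by
        rw [Finset.sum_eq_single_of_mem t ht]
        · simp
        · intro s _ hst
          simp [hst.symm]
      simp only [Pi.add_apply, Pi.smul_apply, Finset.sum_apply] at this ⊢
      rw [this]
      simp
    rw [annihSum_add_left, annihSum_smul_left, annihSum_sum_left, neg_one_smul,
      ← sub_eq_add_neg, sub_eq_zero] at h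
    rw [h]
    exact Finset.sum_congr rfl fun s _ => annihSum_smul_left _ _ _

theorem finite_support_annih (p : ℕ) (k : KetSpace K) :
    (Function.support fun s => create (p + s) (annih s k)).Finite := by
  obtain ⟨T, hT, -⟩ := exists_annihSum_eq k
  refine T.finite_toSet.subset fun s hs => ?_
  by_contra h
  exact hs (by simp only [hT s h, create_zero])

theorem current_add (p : ℕ) (k k' : KetSpace K) :
    current p (k + k') = current p k + current p k' := by
  rw [current, current, current,
    ← finsum_add_distrib (finite_support_annih p k) (finite_support_annih p k')]
  exact finsum_congr fun s => by rw [annih, annihSum_add, create_add]; rfl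

theorem current_smul (p : ℕ) (a : K) (k : KetSpace K) :
    current p (a • k) = a • current p k := by
  rw [current, current, smul_finsum' _ (finite_support_annih p k)]
  exact finsum_congr fun s => by rw [annih, annihSum_smul, create_smul]; rfl

theorem current_one (p : ℕ) : current p (1 : KetSpace K) = 0 := by
  simp [current, annih, annihSum_one, create_zero]

/-- The current `J_p` acts on kets as the derivation induced by the shift `e_t ↦ e_{t+p}`. -/
theorem current_create (p t : ℕ) (k : KetSpace K) :
    current p (create t k) = create (t + p) k + create t (current p k) := by
  have h1 : ∀ s, create (p + s) (annih s (create t k)) =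
      (if s = t then create (t + p) k else 0) + create t (create (p + s) (annih s k)) := by
    intro s
    rw [annih, annihSum_create, sub_eq_add_neg, create_add, create_neg, create_create (p + s) t,
      neg_neg, create_smul]
    congr 1
    split_ifs with h
    · subst h
      simp [add_comm]
    · rw [Pi.single_eq_of_ne (Ne.symm h), zero_smul]
  have hf : (Function.support fun s => if s = t then create (t + p) k else 0).Finite :=
    (Set.finite_singleton t).subset fun s hs => by
      by_contra h
      exact hs (if_neg h)
  have hg : (Function.support fun s => create t (create (p + s) (annih s k))).Finite :=
    (finite_support_annih p k).subset fun s hs h => hs (by simp only [h, create_zero])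
  rw [current, finsum_congr h1, finsum_add_distrib hf hg,
    finsum_eq_single _ t fun s hs => if_neg hs, if_pos rfl]
  congr 1
  exact (AddMonoidHom.map_finsum
    (AddMonoidHom.mulLeft (ExteriorAlgebra.ι K (Finsupp.single t (1 : K))))
      (finite_support_annih p k)).symm

/-- The current `J_p` as a linear endomorphism of the ket space. -/
def currentLin (p : ℕ) : Module.End K (KetSpace K) where
  toFun := current p
  map_add' := current_add p
  map_smul' := current_smul p

theorem current_zero (p : ℕ) : current p (0 : KetSpace K) = 0 := map_zero (currentLin p)

theorem current_sum {ι : Type*} (T : Finset ι) (p : ℕ) (k : ι → KetSpace K) :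
    current p (∑ i ∈ T, k i) = ∑ i ∈ T, current p (k i) := map_sum (currentLin p) _ _

theorem current_comm (p q : ℕ) (k : KetSpace K) :
    current p (current q k) = current q (current p k) := by
  induction k using ket_induction with
  | one => simp only [current_one, current_zero]
  | add k k' h h' => simp only [current_add, h, h']
  | smul a k h => simp only [current_smul, h]
  | create t k h =>
    simp only [current_create, current_add, h, add_right_comm t p q]
    abel

theorem current_iterate_create_one (p t : ℕ) :
    (current 1)^[p] (create t (1 : KetSpace K)) = create (t + p) 1 := by
  induction p with
  | zero => rfl
  | succ p ih =>
    rw [Function.iterate_succ_apply', ih, current_create, current_one, create_zero, add_zero]; rfl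

/-! ### Bras as reversed kets -/

/-- The reversal antiautomorphism, which exchanges kets and bras. -/
abbrev rev (k : ExteriorAlgebra K (ℕ →₀ K)) : ExteriorAlgebra K (ℕ →₀ K) :=
  CliffordAlgebra.reverse k

theorem rev_rev (k : KetSpace K) : rev (rev k) = k := CliffordAlgebra.reverse_reverse k

theorem vac_add (k k' : KetSpace K) : vac (k + k') = vac k + vac k' := map_add _ _ _

theorem vac_smul (a : K) (k : KetSpace K) : vac (a • k) = a * vac k := map_smul _ _ _

theorem vac_one : vac (1 : KetSpace K) = 1 := map_one _

theorem vac_create (s : ℕ) (k : KetSpace K) : vac (create s k) = 0 := by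
  simp [vac, create, ExteriorAlgebra.algebraMapInv]

theorem rev_create (s : ℕ) (k : KetSpace K) : rev (create s k) = braAnnih (rev k) s := by
  simp only [rev, create, braAnnih, CliffordAlgebra.reverse.map_mul]
  rw [CliffordAlgebra.reverse_ι]

theorem rev_annihSum (c : ℕ → K) (k : KetSpace K) :
    rev (annihSum c k) = braCreateSum (rev k) c := by
  rw [braCreateSum, CliffordAlgebra.contractRight_eq, rev, CliffordAlgebra.reverse_reverse]; rfl

theorem vac_rev (k : KetSpace K) : vac (rev k) = vac k := by
  induction k using ket_induction with
  | one => rw [rev, CliffordAlgebra.reverse.map_one]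
  | add k k' h h' => rw [rev, map_add, vac_add, vac_add, ← h, ← h']
  | smul a k h => rw [rev, map_smul, vac_smul, vac_smul, ← h]
  | create t k h =>
    rw [rev_create, vac_create, braAnnih]
    simp [vac, ExteriorAlgebra.algebraMapInv]

theorem rev_ket (m : ℕ) : rev (ket K m) = bra K m := by
  induction m with
  | zero => exact CliffordAlgebra.reverse.map_one
  | succ m ih => rw [ket, rev_create, ih, bra]

theorem rev_bra (m : ℕ) : rev (bra K m) = ket K m := by rw [← rev_ket, rev_rev]

theorem rev_braAnnih (b : BraSpace K) (s : ℕ) : rev (braAnnih b s) = create s (rev b) := by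
  rw [← rev_rev b, ← rev_create, rev_rev, rev_rev]

theorem rev_braCreateSum (b : BraSpace K) (c : ℕ → K) :
    rev (braCreateSum b c) = annihSum c (rev b) := by
  rw [← rev_rev b, ← rev_annihSum, rev_rev, rev_rev]

theorem rev_braCreate (b : BraSpace K) (s : ℕ) : rev (braCreate b s) = annih s (rev b) :=
  rev_braCreateSum _ _

theorem rev_annih (s : ℕ) (k : KetSpace K) : rev (annih s k) = braCreate (rev k) s :=
  rev_annihSum _ _

theorem rev_braCurrent (p : ℕ) (b : BraSpace K) : rev (braCurrent p b) = current p (rev b) := by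
  have hb : (Function.support fun s => braAnnih (braCreate b s) (p + s)).Finite := by
    refine (finite_support_annih p (rev b)).subset fun s hs h => hs ?_
    have := congrArg rev h
    simpa only [rev_create, rev_annih, rev_rev, rev, map_zero] using this
  rw [braCurrent, current]
  refine (AddMonoidHom.map_finsum
    ((CliffordAlgebra.reverse : KetSpace K →ₗ[K] KetSpace K).toAddMonoidHom) hb).trans
    (finsum_congr fun s => ?_)
  change rev (braAnnih (braCreate b s) (p + s)) = _
  rw [rev_braAnnih, rev_braCreate]

/-! ### The states with charge `m` -/

theorem create_ket_of_lt {t m : ℕ} (h : t < m) : create t (ket K m) = 0 := by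
  induction m with
  | zero => omega
  | succ m ih =>
    rw [ket]
    rcases Nat.lt_succ_iff_lt_or_eq.1 h with h | rfl
    · rw [create_create, ih h, create_zero, neg_zero]
    · exact create_create_self _ _

theorem annih_create (s t : ℕ) (k : KetSpace K) :
    annih s (create t k) = (if s = t then k else 0) - create t (annih s k) := by
  rw [annih, annihSum_create]
  congr 1
  split_ifs with h
  · subst h; simp
  · rw [Pi.single_eq_of_ne (Ne.symm h), zero_smul]

theorem annih_ket_of_le {s m : ℕ} (h : m ≤ s) : annih s (ket K m) = 0 := by
  induction m with
  | zero => exact annihSum_one _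
  | succ m ih =>
    rw [ket, annih_create, if_neg (by omega), ih (by omega), create_zero, sub_zero]

theorem annih_ket_self (m : ℕ) : annih m (ket K (m + 1)) = ket K m := by
  rw [ket, annih_create, if_pos rfl, annih_ket_of_le le_rfl, create_zero, sub_zero]

theorem annihSum_ket (c : ℕ → K) (m : ℕ) :
    annihSum c (ket K m) = ∑ s ∈ Finset.range m, c s • annih s (ket K m) := by
  induction m with
  | zero => exact annihSum_one _
  | succ m ih =>
    rw [Finset.sum_range_succ, annih_ket_self, ket, annihSum_create, ih, create_sum, sub_eq_add_neg,
      add_comm, ← Finset.sum_neg_distrib]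
    congr 1
    refine Finset.sum_congr rfl fun s hs => ?_
    rw [annih_create, if_neg (Finset.mem_range.1 hs).ne, zero_sub, smul_neg, create_smul]

end FockSpace

/-! ### Matrix elements of the embedding operator -/

section EmbeddingForm

variable {K : Type*} [Field K] {n : ℕ} (c cb : Fin (n + 1) → ℕ → K)

/-- The moments `∑_A c_A(i) c̄_A(j)`: the matrix elements of the embedding operator between
one-particle states. -/
def moment (i j : ℕ) : K := ∑ A, c A i * cb A j

theorem moment_swap (i j : ℕ) : moment cb c j i = moment c cb i j :=
  Finset.sum_congr rfl fun _ _ => mul_comm _ _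

/-- The part of the embedding operator built from the fields with index in `T`. -/
def partialForm (T : Finset (Fin (n + 1))) (b : BraSpace K) (k : KetSpace K) : K :=
  ∑ S ∈ T.powerset,
    vac ((S.sort (· ≤ ·)).foldl (fun b' A => braCreateSum b' (cb A)) b) *
      vac ((S.sort (· ≤ ·)).foldl (fun k' A => annihSum (c A) k') k)

theorem embeddingForm_eq_partialForm (b : BraSpace K) (k : KetSpace K) :
    embeddingForm c cb b k = partialForm c cb Finset.univ b k := by
  rw [embeddingForm, partialForm, Finset.powerset_univ]

/-- A new smallest field either is absent or acts first, on both sides. -/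
theorem partialForm_insert {a : Fin (n + 1)} {T : Finset (Fin (n + 1))} (h : ∀ x ∈ T, a < x)
    (b : BraSpace K) (k : KetSpace K) :
    partialForm c cb (insert a T) b k =
      partialForm c cb T b k + partialForm c cb T (braCreateSum b (cb a)) (annihSum (c a) k) := by
  have ha : a ∉ T := fun h' => lt_irrefl _ (h a h')
  rw [partialForm, Finset.sum_powerset_insert ha]
  congr 1
  refine Finset.sum_congr rfl fun S hS => ?_
  have hS' : ∀ x ∈ S, x ∈ T := fun x hx => Finset.mem_powerset.1 hS hx
  rw [Finset.sort_insert (· ≤ ·) (fun x hx => (h x (hS' x hx)).le) fun h' => ha (hS' a h')]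
  rfl

theorem partialForm_empty (b : BraSpace K) (k : KetSpace K) :
    partialForm c cb ∅ b k = vac b * vac k := by
  simp [partialForm]

theorem rev_foldl_annihSum (L : List (Fin (n + 1))) (k : KetSpace K) :
    rev (L.foldl (fun k' A => annihSum (c A) k') k) =
      L.foldl (fun b' A => braCreateSum b' (c A)) (rev k) := by
  induction L generalizing k with
  | nil => rfl
  | cons A L ih => rw [List.foldl_cons, List.foldl_cons, ih, rev_annihSum]

/-- Reversal exchanges the two chiralities. -/
theorem partialForm_swap (T : Finset (Fin (n + 1))) (b : BraSpace K) (k : KetSpace K) :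
    partialForm cb c T (rev k) (rev b) = partialForm c cb T b k := by
  refine Finset.sum_congr rfl fun S _ => ?_
  rw [mul_comm, ← rev_foldl_annihSum, vac_rev, ← vac_rev (List.foldl _ (rev b) _),
    rev_foldl_annihSum, rev_rev]

theorem embeddingForm_swap (b : BraSpace K) (k : KetSpace K) :
    embeddingForm cb c (rev k) (rev b) = embeddingForm c cb b k := by
  rw [embeddingForm_eq_partialForm, partialForm_swap, embeddingForm_eq_partialForm]

theorem foldl_annihSum_add (L : List (Fin (n + 1))) (k k' : KetSpace K) :
    L.foldl (fun k' A => annihSum (c A) k') (k + k') =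
      L.foldl (fun k' A => annihSum (c A) k') k + L.foldl (fun k' A => annihSum (c A) k') k' := by
  induction L generalizing k k' with
  | nil => rfl
  | cons A L ih => simp only [List.foldl_cons, annihSum_add, ih]

theorem foldl_annihSum_smul (L : List (Fin (n + 1))) (a : K) (k : KetSpace K) :
    L.foldl (fun k' A => annihSum (c A) k') (a • k) =
      a • L.foldl (fun k' A => annihSum (c A) k') k := by
  induction L generalizing k with
  | nil => rfl
  | cons A L ih => simp only [List.foldl_cons, annihSum_smul, ih]

theorem partialForm_add (T : Finset (Fin (n + 1))) (b : BraSpace K) (k k' : KetSpace K) :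
    partialForm c cb T b (k + k') = partialForm c cb T b k + partialForm c cb T b k' := by
  simp only [partialForm, foldl_annihSum_add, vac_add, mul_add, Finset.sum_add_distrib]

theorem partialForm_smul (T : Finset (Fin (n + 1))) (b : BraSpace K) (a : K) (k : KetSpace K) :
    partialForm c cb T b (a • k) = a * partialForm c cb T b k := by
  simp only [partialForm, foldl_annihSum_smul, vac_smul, Finset.mul_sum]
  exact Finset.sum_congr rfl fun _ _ => by ring

/-- `𝒢` restricted to a bra, as a linear form on kets. -/
def embeddingLin (b : BraSpace K) : KetSpace K →ₗ[K] K where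
  toFun := embeddingForm c cb b
  map_add' k k' := by simp only [embeddingForm_eq_partialForm, partialForm_add]
  map_smul' a k := by
    simp only [embeddingForm_eq_partialForm, partialForm_smul, RingHom.id_apply, smul_eq_mul]

theorem embeddingForm_add (b : BraSpace K) (k k' : KetSpace K) :
    embeddingForm c cb b (k + k') = embeddingForm c cb b k + embeddingForm c cb b k' :=
  map_add (embeddingLin c cb b) _ _

theorem embeddingForm_smul (b : BraSpace K) (a : K) (k : KetSpace K) :
    embeddingForm c cb b (a • k) = a * embeddingForm c cb b k :=
  map_smul (embeddingLin c cb b) _ _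

theorem embeddingForm_zero (b : BraSpace K) : embeddingForm c cb b (0 : KetSpace K) = 0 :=
  map_zero (embeddingLin c cb b)

theorem embeddingForm_sum {ι : Type*} (T : Finset ι) (b : BraSpace K) (k : ι → KetSpace K) :
    embeddingForm c cb b (∑ i ∈ T, k i) = ∑ i ∈ T, embeddingForm c cb b (k i) :=
  map_sum (embeddingLin c cb b) _ _

theorem partialForm_sub (T : Finset (Fin (n + 1))) (b : BraSpace K) (k k' : KetSpace K) :
    partialForm c cb T b (k - k') = partialForm c cb T b k - partialForm c cb T b k' := by
  rw [sub_eq_add_neg, partialForm_add, ← neg_one_smul K k', partialForm_smul]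
  ring

theorem partialForm_add_left (T : Finset (Fin (n + 1))) (b b' : BraSpace K) (k : KetSpace K) :
    partialForm c cb T (b + b') k = partialForm c cb T b k + partialForm c cb T b' k := by
  simp only [← partialForm_swap c cb, rev, map_add, partialForm_add]

theorem partialForm_smul_left (T : Finset (Fin (n + 1))) (a : K) (b : BraSpace K)
    (k : KetSpace K) : partialForm c cb T (a • b) k = a * partialForm c cb T b k := by
  simp only [← partialForm_swap c cb, rev, map_smul, partialForm_smul]

theorem braCreateSum_add (b : BraSpace K) (d e : ℕ → K) :
    braCreateSum b (d + e) = braCreateSum b d + braCreateSum b e := by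
  simp only [braCreateSum, modeForm_add, map_add]

theorem braCreateSum_smul (b : BraSpace K) (a : K) (d : ℕ → K) :
    braCreateSum b (a • d) = a • braCreateSum b d := by
  simp only [braCreateSum, modeForm_smul, map_smul]

theorem braCreateSum_add_left (b b' : BraSpace K) (d : ℕ → K) :
    braCreateSum (b + b') d = braCreateSum b d + braCreateSum b' d := by
  simp only [braCreateSum, map_add, LinearMap.add_apply]

theorem braCreateSum_smul_left (a : K) (b : BraSpace K) (d : ℕ → K) :
    braCreateSum (a • b) d = a • braCreateSum b d := by
  simp only [braCreateSum, map_smul, LinearMap.smul_apply]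

/-- Moving a creation operator through `𝒢`: `𝒢_T ψ⁺_t = (∑_{A ∈ T} c_A(t) ψ⁺_{c̄_A}) 𝒢_T`. The
induction peels off the smallest field; the two mixed terms cancel by anticommutation. -/
theorem partialForm_create (T : Finset (Fin (n + 1))) (b : BraSpace K) (t : ℕ) (k : KetSpace K) :
    partialForm c cb T b (create t k) =
      partialForm c cb T (braCreateSum b (∑ A ∈ T, c A t • cb A)) k := by
  induction T using Finset.induction_on_min generalizing b k with
  | empty =>
    rw [Finset.sum_empty, partialForm_empty, partialForm_empty, vac_create]
    have := braCreateSum_smul b 0 0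
    rw [zero_smul, zero_smul] at this
    rw [this]
    simp [vac]
  | insert a T h ih =>
    have ha : a ∉ T := fun h' => lt_irrefl _ (h a h')
    rw [partialForm_insert _ _ h, partialForm_insert _ _ h, Finset.sum_insert ha, annihSum_create,
      partialForm_sub, partialForm_smul, ih, ih]
    set d := ∑ A ∈ T, c A t • cb A
    have h1 : braCreateSum (braCreateSum b (c a t • cb a + d)) (cb a) =
        (-1 : K) • braCreateSum (braCreateSum b (cb a)) d := by
      rw [braCreateSum_add, braCreateSum_add_left, braCreateSum_smul, braCreateSum_smul_left]
      simp only [braCreateSum, CliffordAlgebra.contractRight_contractRight, smul_zero, zero_add]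
      rw [CliffordAlgebra.contractRight_comm, neg_one_smul]
    rw [h1, partialForm_smul_left, braCreateSum_add, partialForm_add_left, braCreateSum_smul,
      partialForm_smul_left]
    ring

/-- `𝒢 ψ⁺_t = ψ⁺_{η(t, ·)} 𝒢`. -/
theorem embeddingForm_create (b : BraSpace K) (t : ℕ) (k : KetSpace K) :
    embeddingForm c cb b (create t k) =
      embeddingForm c cb (braCreateSum b (moment c cb t)) k := by
  have : moment c cb t = ∑ A, c A t • cb A := by
    ext j; simp [moment, Finset.sum_apply]
  rw [embeddingForm_eq_partialForm, partialForm_create, this, embeddingForm_eq_partialForm]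

/-- `ψ_t 𝒢 = 𝒢 ψ_{η(·, t)}`. -/
theorem embeddingForm_braAnnih (b : BraSpace K) (t : ℕ) (k : KetSpace K) :
    embeddingForm c cb (braAnnih b t) k =
      embeddingForm c cb b (annihSum (moment cb c t) k) := by
  rw [← embeddingForm_swap, rev_braAnnih, embeddingForm_create, ← rev_annihSum,
    embeddingForm_swap]

theorem embeddingForm_one_right (b : BraSpace K) : embeddingForm c cb b 1 = vac b := by
  have h : ∀ T : Finset (Fin (n + 1)), partialForm c cb T b 1 = vac b := by
    intro T
    induction T using Finset.induction_on_min with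
    | empty => rw [partialForm_empty, vac_one, mul_one]
    | insert a T h ih =>
      have := partialForm_smul c cb T (braCreateSum b (cb a)) 0 0
      rw [zero_smul, zero_mul] at this
      rw [partialForm_insert _ _ h, ih, annihSum_one, this, add_zero]
  rw [embeddingForm_eq_partialForm, h]

theorem embeddingForm_one_left (k : KetSpace K) : embeddingForm c cb 1 k = vac k := by
  rw [← embeddingForm_swap, show rev (1 : KetSpace K) = 1 from CliffordAlgebra.reverse.map_one,
    embeddingForm_one_right, vac_rev]

end EmbeddingForm

/-! ### Determinants as iterated contractions -/

section Det

variable {K : Type*} [Field K]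

/-- The ket `ψ⁺_{w₀} ⋯ ψ⁺_{w_{a-1}} |∅⟩`. -/
def ketOf {a : ℕ} (w : Fin a → ℕ) : KetSpace K :=
  (List.ofFn w).foldr create 1

theorem ketOf_succ {a : ℕ} (w : Fin (a + 1) → ℕ) :
    ketOf (K := K) w = create (w 0) (ketOf fun i => w i.succ) := by
  rw [ketOf, List.ofFn_succ, List.foldr_cons, ketOf]

/-- Laplace expansion of a contraction. -/
theorem annihSum_ketOf {a : ℕ} (c : ℕ → K) (w : Fin (a + 1) → ℕ) :
    annihSum c (ketOf w) =
      ∑ j : Fin (a + 1), ((-1) ^ (j : ℕ) * c (w j)) • ketOf (w ∘ j.succAbove) := by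
  induction a with
  | zero =>
    rw [ketOf_succ, annihSum_create]
    simp [ketOf, annihSum_one, create_zero]
  | succ a ih =>
    rw [ketOf_succ, annihSum_create, ih, Fin.sum_univ_succ (n := a + 1), create_sum, sub_eq_add_neg,
      ← Finset.sum_neg_distrib]
    congr 1
    · simp only [Fin.val_zero, pow_zero, one_mul]; rfl
    · refine Finset.sum_congr rfl fun j _ => ?_
      rw [ketOf_succ (w ∘ j.succ.succAbove), create_smul, ← neg_smul]
      congr 1
      · simp [pow_succ]
      · simp only [Function.comp_def, Fin.succ_succAbove_zero, Fin.succ_succAbove_succ]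

/-- The full contraction of a product of modes is a determinant, by expansion along the first
row. -/
theorem vac_foldl_annihSum_ketOf {a : ℕ} (d : Fin a → ℕ → K) (w : Fin a → ℕ) :
    vac ((List.ofFn d).foldl (fun k' c => annihSum c k') (ketOf w)) =
      Matrix.det (Matrix.of fun i j => d i (w j)) := by
  induction a with
  | zero => simp [ketOf, vac_one]
  | succ a ih =>
    have hsum : ∀ (L : List (ℕ → K)) (T : Finset (Fin (a + 1))) (r : Fin (a + 1) → K)
        (k : Fin (a + 1) → KetSpace K),
        vac (L.foldl (fun k' c => annihSum c k') (∑ j ∈ T, r j • k j)) =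
          ∑ j ∈ T, r j * vac (L.foldl (fun k' c => annihSum c k') (k j)) := by
      intro L T r k
      induction L generalizing k with
      | nil =>
        simp only [List.foldl_nil, vac, map_sum, map_smul, smul_eq_mul]
      | cons c L ihL =>
        simp only [List.foldl_cons]
        rw [← ihL]
        congr 2
        simp only [annihSum, map_sum, map_smul]
    rw [List.ofFn_succ, List.foldl_cons, annihSum_ketOf, hsum, Matrix.det_succ_row_zero]
    refine Finset.sum_congr rfl fun j _ => ?_
    rw [ih]
    rfl

theorem ketOf_rev (l : ℕ) : ketOf (K := K) (fun i : Fin l => (Fin.rev i : ℕ)) = ket K l := by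
  induction l with
  | zero => rfl
  | succ l ih =>
    rw [ketOf_succ, ket, ← ih]
    congr 2
    simp

variable {n : ℕ} (c cb : Fin (n + 1) → ℕ → K)

/-- Moving the modes of `⟨ℓ|` through `𝒢` one by one turns the matrix element into an iterated
contraction. -/
theorem embeddingForm_bra (l : ℕ) (k : KetSpace K) :
    embeddingForm c cb (bra K l) k =
      vac ((List.ofFn fun i : Fin l => moment cb c (Fin.rev i : ℕ)).foldl
        (fun k' d => annihSum d k') k) := by
  induction l generalizing k with
  | zero => exact embeddingForm_one_left c cb k
  | succ l ih =>
    rw [bra, embeddingForm_braAnnih, ih, List.ofFn_succ, List.foldl_cons]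
    congr 3
    simp [Fin.rev_succ]

/-- Contracting `|ℓ+1⟩` with `d` and then pairing with `⟨ℓ| 𝒢` is a determinant with last
row `d`. -/
theorem embeddingForm_bra_annihSum_ket (l : ℕ) (d : ℕ → K) :
    embeddingForm c cb (bra K l) (annihSum d (ket K (l + 1))) =
      Matrix.det (Matrix.of fun r s : Fin (l + 1) =>
        if (r : ℕ) < l then moment c cb s r else d s) := by
  have h := vac_foldl_annihSum_ketOf (a := l + 1)
    (Fin.cons d fun i : Fin l => moment cb c (Fin.rev i : ℕ)) fun i => (Fin.rev i : ℕ)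
  rw [List.ofFn_succ, List.foldl_cons] at h
  simp only [Fin.cons_zero, Fin.cons_succ] at h
  rw [embeddingForm_bra, ← ketOf_rev, h, ← Matrix.det_submatrix_equiv_self Fin.revPerm]
  congr 1
  ext i j
  have hj : l - (l - (j : ℕ)) = j := by omega
  refine Fin.lastCases ?_ (fun i => ?_) i
  · simp [hj]
  · have hi : l - (l - ((i : ℕ) + 1) + 1) = i := by omega
    simp [Fin.rev_castSucc, moment_swap, hj, hi]

end Det

/-! ### Biorthogonal polynomials of the moment matrix -/

section Biorthogonal

variable {K : Type*} [Field K] {n : ℕ} (c cb : Fin (n + 1) → ℕ → K)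

/-- The tau-function `⟨ℓ| 𝒢 |ℓ⟩` at a point, in terms of the Taylor data. -/
def tauAt (l : ℕ) : K := embeddingForm c cb (bra K l) (ket K l)

/-- The coefficients `⟨ℓ| 𝒢 ψ_s |ℓ+1⟩` of the `ℓ`-th biorthogonal polynomial
`P_ℓ(X) = ∑_{s ≤ ℓ} ⟨ℓ| 𝒢 ψ_s |ℓ+1⟩ X^s`; the polynomials `Q_ℓ` of the other chirality are obtained
by exchanging `c` and `cb`. -/
def coef (l s : ℕ) : K := embeddingForm c cb (bra K l) (annih s (ket K (l + 1)))

/-- The pairing of `P_ℓ` with the monomial `Y^t`. -/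
def polyPair (l t : ℕ) : K := ∑ s ∈ Finset.range (l + 1), coef c cb l s * moment c cb s t

/-- The vector `P_ℓ(∂) f`. -/
def frame (l : ℕ) (A : Fin (n + 1)) : K := ∑ s ∈ Finset.range (l + 1), coef c cb l s * c A s

/-- The pairing of `X^p P_ℓ` with `Q_m`. -/
def shiftPair (p l m : ℕ) : K :=
  ∑ s ∈ Finset.range (l + 1), coef c cb l s * polyPair cb c m (s + p)

/-- The coefficient of `P_m` in the expansion of `X^p P_ℓ`. -/
def shiftCoef (p l m : ℕ) : K :=
  (tauAt c cb m * tauAt c cb (m + 1))⁻¹ * shiftPair c cb p l m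

theorem tauAt_swap (l : ℕ) : tauAt cb c l = tauAt c cb l := by
  rw [tauAt, ← embeddingForm_swap, rev_bra, rev_ket, tauAt]

theorem coef_eq_zero {l s : ℕ} (h : l < s) : coef c cb l s = 0 := by
  rw [coef, annih_ket_of_le h, embeddingForm_zero]

theorem coef_self (l : ℕ) : coef c cb l l = tauAt c cb l := by
  rw [coef, annih_ket_self, tauAt]

theorem coef_swap (l s : ℕ) :
    coef cb c l s = embeddingForm c cb (braCreate (bra K (l + 1)) s) (ket K l) := by
  rw [coef, ← embeddingForm_swap, rev_bra, rev_annih, rev_ket]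

theorem embeddingForm_bra_annihSum (l : ℕ) (d : ℕ → K) :
    embeddingForm c cb (bra K l) (annihSum d (ket K (l + 1))) =
      ∑ s ∈ Finset.range (l + 1), coef c cb l s * d s := by
  rw [annihSum_ket, embeddingForm_sum]
  exact Finset.sum_congr rfl fun s _ => by rw [embeddingForm_smul, mul_comm, coef]

theorem polyPair_eq (l t : ℕ) :
    polyPair c cb l t = embeddingForm c cb (braAnnih (bra K l) t) (ket K (l + 1)) := by
  rw [embeddingForm_braAnnih, embeddingForm_bra_annihSum, polyPair]
  simp only [moment_swap]

theorem polyPair_swap (m t : ℕ) :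
    polyPair cb c m t = embeddingForm c cb (bra K (m + 1)) (create t (ket K m)) := by
  rw [polyPair_eq, ← embeddingForm_swap, rev_braAnnih, rev_bra, rev_ket]

theorem polyPair_of_lt {l t : ℕ} (h : t < l) : polyPair c cb l t = 0 := by
  rw [polyPair_swap, create_ket_of_lt h, embeddingForm_zero]

theorem polyPair_self (l : ℕ) : polyPair c cb l l = tauAt c cb (l + 1) := by
  rw [polyPair_eq, ← bra, tauAt]

/-- The expansion along the last row of the determinant defining `ṽ_ℓ` is `P_ℓ(∂) f`. -/
theorem frame_eq_det (l : ℕ) (A : Fin (n + 1)) :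
    frame c cb l A = Matrix.det (Matrix.of fun r s : Fin (l + 1) =>
        if (r : ℕ) < l then moment c cb s r else c A s) := by
  rw [frame, ← embeddingForm_bra_annihSum, embeddingForm_bra_annihSum_ket]

theorem sum_frame_mul (l t : ℕ) : ∑ A, frame c cb l A * cb A t = polyPair c cb l t := by
  simp only [frame, polyPair, moment, Finset.sum_mul, Finset.mul_sum]
  rw [Finset.sum_comm]
  simp only [mul_assoc]

theorem sum_mul_polyPair (l m : ℕ) :
    ∑ A, frame c cb l A * frame cb c m A =
      ∑ t ∈ Finset.range (m + 1), coef cb c m t * polyPair c cb l t := by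
  simp only [← sum_frame_mul, Finset.mul_sum]
  rw [Finset.sum_comm]
  refine Finset.sum_congr rfl fun A _ => ?_
  rw [frame.eq_1 cb c, Finset.mul_sum]
  exact Finset.sum_congr rfl fun _ _ => by ring

theorem sum_frame_mul_frame (l m : ℕ) :
    ∑ A, frame c cb l A * frame cb c m A =
      if l = m then tauAt c cb l * tauAt c cb (l + 1) else 0 := by
  have key : ∀ c cb : Fin (n + 1) → ℕ → K, ∀ l m, m < l →
      ∑ A, frame c cb l A * frame cb c m A = 0 := by
    intro c cb l m h
    rw [sum_mul_polyPair]
    refine Finset.sum_eq_zero fun t ht => ?_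
    rw [polyPair_of_lt c cb (by rw [Finset.mem_range] at ht; omega), mul_zero]
  rcases lt_trichotomy l m with h | rfl | h
  · rw [if_neg h.ne, ← key cb c m l h]
    exact Finset.sum_congr rfl fun _ _ => mul_comm _ _
  · rw [if_pos rfl, sum_mul_polyPair, Finset.sum_range_succ, coef_self, polyPair_self,
      tauAt_swap, Finset.sum_eq_zero, zero_add]
    intro t ht
    rw [polyPair_of_lt c cb (Finset.mem_range.1 ht), mul_zero]
  · rw [if_neg h.ne', key c cb l m h]

theorem shiftPair_zero (l m : ℕ) :
    shiftPair c cb 0 l m = if l = m then tauAt c cb l * tauAt c cb (l + 1) else 0 := by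
  have := sum_mul_polyPair cb c m l
  simp only [shiftPair, add_zero]
  rw [← this, ← sum_frame_mul_frame]
  exact Finset.sum_congr rfl fun _ _ => mul_comm _ _

theorem shiftPair_of_lt {p l m : ℕ} (h : l + p < m) : shiftPair c cb p l m = 0 := by
  refine Finset.sum_eq_zero fun s hs => ?_
  rw [polyPair_of_lt cb c (by rw [Finset.mem_range] at hs; omega), mul_zero]

theorem shiftCoef_of_lt {p l m : ℕ} (h : l + p < m) : shiftCoef c cb p l m = 0 := by
  rw [shiftCoef, shiftPair_of_lt c cb h, mul_zero]

theorem sum_shift_mul_frame (p l m : ℕ) :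
    ∑ A, (∑ s ∈ Finset.range (l + 1), coef c cb l s * c A (s + p)) * frame cb c m A =
      shiftPair c cb p l m := by
  simp only [shiftPair, ← sum_frame_mul, Finset.sum_mul, Finset.mul_sum]
  rw [Finset.sum_comm]
  exact Finset.sum_congr rfl fun _ _ => Finset.sum_congr rfl fun _ _ => by ring

variable {c cb}

/-- The vectors `P_m(∂) f` and `Q_m(∂̄) f̄` form dual bases, up to normalization. -/
theorem frame_expansion (hτ : ∀ l ≤ n + 1, tauAt c cb l ≠ 0) (w : Fin (n + 1) → K)
    (A : Fin (n + 1)) :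
    w A = ∑ m ∈ Finset.range (n + 1), ((tauAt c cb m * tauAt c cb (m + 1))⁻¹ *
      ∑ B, w B * frame cb c m B) * frame c cb m A := by
  let R : Matrix (Fin (n + 1)) (Fin (n + 1)) K := Matrix.of fun i B =>
    (tauAt c cb i * tauAt c cb (i + 1))⁻¹ * frame cb c i B
  let S : Matrix (Fin (n + 1)) (Fin (n + 1)) K := Matrix.of fun B j => frame c cb j B
  have h : R * S = 1 := by
    ext i j
    have h1 : (R * S) i j = (tauAt c cb i * tauAt c cb (i + 1))⁻¹ *
        ∑ B, frame c cb j B * frame cb c i B := by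
      simp only [R, S, Matrix.mul_apply, Matrix.of_apply, Finset.mul_sum]
      exact Finset.sum_congr rfl fun _ _ => by ring
    rw [h1, sum_frame_mul_frame, Matrix.one_apply]
    by_cases hij : i = j
    · subst hij
      rw [if_pos rfl, if_pos rfl, inv_mul_cancel₀]
      exact mul_ne_zero (hτ _ (by omega)) (hτ _ (by omega))
    · rw [if_neg hij, if_neg fun h => hij (Fin.ext h.symm), mul_zero]
  -- duality says that `S` is a right inverse of the square matrix `R`, hence also a left inverse
  have h' : S.mulVec (R.mulVec w) = w := by
    rw [Matrix.mulVec_mulVec, mul_eq_one_comm.1 h, Matrix.one_mulVec]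
  rw [← Fin.sum_univ_eq_sum_range fun m => ((tauAt c cb m * tauAt c cb (m + 1))⁻¹ *
      ∑ B, w B * frame cb c m B) * frame c cb m A]
  conv_lhs => rw [← h']
  simp only [Matrix.mulVec, dotProduct, R, S, Matrix.of_apply, Finset.mul_sum, Finset.sum_mul]
  exact Finset.sum_congr rfl fun _ _ => Finset.sum_congr rfl fun _ _ => by ring

/-- Expansion of a polynomial of degree less than `k ≤ n + 1` (with coefficients `a`) in the
biorthogonal polynomials; `M` is any bound for the range of summation. -/
theorem poly_expansion (hτ : ∀ l ≤ n + 1, tauAt c cb l ≠ 0) (M k : ℕ) (hk : k ≤ n + 1)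
    (hM : k ≤ M) (a : ℕ → K) (ha : ∀ s, k ≤ s → a s = 0) (s : ℕ) :
    a s = ∑ m ∈ Finset.range k, ((tauAt c cb m * tauAt c cb (m + 1))⁻¹ *
      ∑ t ∈ Finset.range M, a t * polyPair cb c m t) * coef c cb m s := by
  induction k generalizing a with
  | zero => simp [ha s (Nat.zero_le s)]
  | succ k ih =>
    have hk0 := hτ k (by omega)
    have hk1 := hτ (k + 1) hk
    have hext : ∀ m, ∑ t ∈ Finset.range M, coef c cb k t * polyPair cb c m t =
        if k = m then tauAt c cb k * tauAt c cb (k + 1) else 0 := by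
      intro m
      rw [← shiftPair_zero, shiftPair, ← Finset.sum_subset (Finset.range_mono hM)]
      · rfl
      · intro t _ ht
        rw [coef_eq_zero c cb (by rw [Finset.mem_range] at ht; omega), zero_mul]
    have hlead : ∑ t ∈ Finset.range M, a t * polyPair cb c k t = a k * tauAt c cb (k + 1) := by
      rw [Finset.sum_eq_single_of_mem k (Finset.mem_range.2 hM), polyPair_self, tauAt_swap]
      intro t _ ht
      rcases lt_or_gt_of_ne ht with h | h
      · rw [polyPair_of_lt cb c h, mul_zero]
      · rw [ha t h, zero_mul]
    -- subtracting a multiple of `P_k` removes the leading term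
    have := ih (by omega) (by omega) (fun t => a t - a k / tauAt c cb k * coef c cb k t)
      fun t ht => by
        rcases Nat.eq_or_lt_of_le ht with rfl | h
        · rw [coef_self]; field_simp; ring
        · rw [ha t h, coef_eq_zero c cb h, mul_zero, sub_zero]
    rw [sub_eq_iff_eq_add] at this
    rw [this, Finset.sum_range_succ, hlead]
    congr 1
    · refine Finset.sum_congr rfl fun m hm => ?_
      have hmk : k ≠ m := (Finset.mem_range.1 hm).ne'
      congr 2
      have h2 : ∀ t, (a t - a k / tauAt c cb k * coef c cb k t) * polyPair cb c m t =
          a t * polyPair cb c m t -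
            a k / tauAt c cb k * (coef c cb k t * polyPair cb c m t) := fun t => by ring
      simp only [h2, Finset.sum_sub_distrib, ← Finset.mul_sum, hext, if_neg hmk, mul_zero, sub_zero]
    · field_simp

/-- For `ℓ < n` the polynomial `X P_ℓ` has degree at most `n`, so its expansion in the `P_m` is
exact. -/
theorem shiftPair_succ (hτ : ∀ l ≤ n + 1, tauAt c cb l ≠ 0) {l : ℕ} (hl : l < n) (p j : ℕ) :
    shiftPair c cb (p + 1) l j =
      ∑ m ∈ Finset.range (l + 2), shiftCoef c cb 1 l m * shiftPair c cb p m j := by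
  have hsum : ∀ g : ℕ → K, ∑ t ∈ Finset.range (l + 2), (if t = 0 then 0 else coef c cb l (t - 1)) *
      g t = ∑ s ∈ Finset.range (l + 1), coef c cb l s * g (s + 1) := by
    intro g
    rw [Finset.sum_range_succ']
    simp
  have hexp := poly_expansion hτ (l + 2) (l + 2) (by omega) le_rfl
    (fun t => if t = 0 then 0 else coef c cb l (t - 1)) fun s hs => by
      rw [if_neg (by omega), coef_eq_zero c cb (by omega)]
  simp only [hsum] at hexp
  have h1 : shiftPair c cb (p + 1) l j = ∑ t ∈ Finset.range (l + 2),
      (if t = 0 then 0 else coef c cb l (t - 1)) * polyPair cb c j (t + p) := by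
    rw [hsum fun t => polyPair cb c j (t + p), shiftPair]
    simp only [add_assoc, add_comm 1 p]
  rw [h1]
  simp only [hexp, Finset.sum_mul]
  rw [Finset.sum_comm]
  refine Finset.sum_congr rfl fun m hm => ?_
  rw [Finset.mem_range] at hm
  change ∑ t ∈ Finset.range (l + 2), shiftCoef c cb 1 l m * coef c cb m t *
    polyPair cb c j (t + p) = _
  rw [shiftPair, Finset.mul_sum,
    ← Finset.sum_subset (Finset.range_mono (show m + 1 ≤ l + 2 by omega))]
  · exact Finset.sum_congr rfl fun _ _ => by ring
  · intro t _ ht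
    rw [coef_eq_zero c cb (by rw [Finset.mem_range] at ht; omega)]
    ring

/-- The matrix of multiplication by `X^p` is the `p`-th power of the matrix of multiplication by
`X`, in the rows which the truncation to `n + 1` polynomials does not affect. -/
theorem shiftCoef_eq_pow (hτ : ∀ l ≤ n + 1, tauAt c cb l ≠ 0) (p : ℕ) (l m : Fin (n + 1))
    (h : (l : ℕ) + p ≤ n + 1) :
    shiftCoef c cb p l m =
      ((Matrix.of fun i j : Fin (n + 1) => shiftCoef c cb 1 i j) ^ p) l m := by
  induction p generalizing l with
  | zero =>
    rw [pow_zero, Matrix.one_apply, shiftCoef, shiftPair_zero]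
    by_cases hlm : l = m
    · subst hlm
      rw [if_pos rfl, if_pos rfl, inv_mul_cancel₀]
      exact mul_ne_zero (hτ _ (by omega)) (hτ _ (by omega))
    · rw [if_neg hlm, if_neg fun h => hlm (Fin.ext h), mul_zero]
  | succ p ih =>
    rcases Nat.eq_zero_or_pos p with rfl | hp
    · rw [zero_add, pow_one, Matrix.of_apply]
    have h1 : ∀ j : Fin (n + 1), (Matrix.of fun i j : Fin (n + 1) => shiftCoef c cb 1 i j) l j *
        ((Matrix.of fun i j : Fin (n + 1) => shiftCoef c cb 1 i j) ^ p) j m =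
        shiftCoef c cb 1 l j * shiftCoef c cb p j m := by
      intro j
      rw [Matrix.of_apply]
      rcases lt_or_ge ((l : ℕ) + 1) j with hj | hj
      · rw [shiftCoef_of_lt c cb hj, zero_mul, zero_mul]
      · rw [ih j (by omega)]
    rw [pow_succ', Matrix.mul_apply, Finset.sum_congr rfl fun j _ => h1 j,
      Fin.sum_univ_eq_sum_range (fun j => shiftCoef c cb 1 l j * shiftCoef c cb p j m) (n + 1),
      shiftCoef, shiftPair_succ hτ (by omega), Finset.mul_sum,
      ← Finset.sum_subset (Finset.range_mono (show (l : ℕ) + 2 ≤ n + 1 by omega))]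
    · exact Finset.sum_congr rfl fun _ _ => by rw [shiftCoef.eq_1 c cb p]; ring
    · intro j _ hj
      rw [shiftCoef_of_lt c cb (by rw [Finset.mem_range] at hj; omega), zero_mul]

variable (c cb)

theorem embeddingForm_one_particle (t j : ℕ) :
    embeddingForm c cb (braAnnih (bra K 0) j) (create t (ket K 0)) = moment c cb t j := by
  rw [embeddingForm_braAnnih, annihSum_create, ket, annihSum_one, create_zero, sub_zero,
    embeddingForm_smul, embeddingForm_one_right, moment_swap, bra, vac_one, mul_one]

theorem embeddingForm_sum_left {ι : Type*} (T : Finset ι) (b : ι → BraSpace K) (k : KetSpace K) :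
    embeddingForm c cb (∑ i ∈ T, b i) k = ∑ i ∈ T, embeddingForm c cb (b i) k := by
  simp only [← embeddingForm_swap c cb, rev, map_sum, embeddingForm_sum]

theorem embeddingForm_smul_left (a : K) (b : BraSpace K) (k : KetSpace K) :
    embeddingForm c cb (a • b) k = a * embeddingForm c cb b k := by
  simp only [← embeddingForm_swap c cb, rev, map_smul, embeddingForm_smul]

/-- The pairing of `X^p P_ℓ` with `Q_m` as a matrix element of `𝒢 (J_1)^p` between one-particle
states. -/
theorem embeddingForm_current_iterate (p l m : ℕ) :
    embeddingForm c cb (∑ s ∈ Finset.range (m + 1), coef cb c m s • braAnnih (bra K 0) s)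
      ((current 1)^[p] (∑ s ∈ Finset.range (l + 1), coef c cb l s • create s (ket K 0))) =
      shiftPair c cb p l m := by
  have h : ∀ T : Finset ℕ, ∀ a : ℕ → K, (current 1)^[p] (∑ s ∈ T, a s • create s (ket K 0)) =
      ∑ s ∈ T, a s • create (s + p) (ket K 0) := by
    intro T a
    have : ∀ k : KetSpace K, (current 1)^[p] k = (currentLin 1 ^ p) k := fun k => by
      rw [Module.End.pow_apply]; rfl
    rw [this, map_sum]
    refine Finset.sum_congr rfl fun s _ => ?_
    rw [map_smul, ← this, ket, current_iterate_create_one]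
  rw [h, embeddingForm_sum]
  refine Finset.sum_congr rfl fun s _ => ?_
  rw [embeddingForm_smul, embeddingForm_sum_left, polyPair]
  congr 1
  refine Finset.sum_congr rfl fun t _ => ?_
  rw [embeddingForm_smul_left, embeddingForm_one_particle, moment_swap]

end Biorthogonal

/-! ### Calculus of line derivatives -/

section LineDeriv

variable {𝕜 : Type*} [RCLike 𝕜] {E : Type*} [NormedAddCommGroup E] [NormedSpace 𝕜 E]
  {V : Type*} [NormedAddCommGroup V] [NormedSpace 𝕜 V]
  {K : Type*} [RCLike K] [NormedAlgebra 𝕜 K]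

theorem eventually_differentiableAt {g : E → V} {x : E} (hg : ContDiffAt 𝕜 ∞ g x) :
    ∀ᶠ y in 𝓝 x, DifferentiableAt 𝕜 g y := by
  have h1 : ContDiffAt 𝕜 1 g x := hg.of_le (by exact_mod_cast le_top)
  filter_upwards [h1.eventually (by simp)] with y hy using hy.differentiableAt one_ne_zero

theorem hasLineDerivAt_of_contDiffAt {g : E → V} {x : E} (hg : ContDiffAt 𝕜 ∞ g x) (v : E) :
    HasLineDerivAt 𝕜 g (lineDeriv 𝕜 g x v) x v :=
  (hg.differentiableAt (by simp)).lineDifferentiableAt.hasLineDerivAt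

theorem lineDeriv_eventuallyEq {g : E → V} {x : E} (hg : ContDiffAt 𝕜 ∞ g x) (v : E) :
    (fun y => lineDeriv 𝕜 g y v) =ᶠ[𝓝 x] fun y => fderiv 𝕜 g y v := by
  filter_upwards [eventually_differentiableAt hg] with y hy using hy.lineDeriv_eq_fderiv

theorem contDiffAt_lineDeriv {g : E → V} {x : E} (hg : ContDiffAt 𝕜 ∞ g x) (v : E) :
    ContDiffAt 𝕜 ∞ (fun y => lineDeriv 𝕜 g y v) x :=
  ((hg.fderiv_right (m := ∞) (by simp)).clm_apply contDiffAt_const).congr_of_eventuallyEq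
    (lineDeriv_eventuallyEq hg v)

theorem lineDeriv_lineDeriv {g : E → V} {x : E} (hg : ContDiffAt 𝕜 ∞ g x) (v w : E) :
    lineDeriv 𝕜 (fun y => lineDeriv 𝕜 g y v) x w = fderiv 𝕜 (fderiv 𝕜 g) x w v := by
  have h : DifferentiableAt 𝕜 (fderiv 𝕜 g) x :=
    (hg.fderiv_right (m := ∞) (by simp)).differentiableAt (by simp)
  rw [(lineDeriv_eventuallyEq hg v).lineDeriv_eq]
  exact ((h.hasFDerivAt.clm_apply (hasFDerivAt_const v x)).hasLineDerivAt w).lineDeriv.trans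
    (by simp)

theorem lineDeriv_comm {g : E → V} {x : E} (hg : ContDiffAt 𝕜 ∞ g x) (v w : E) :
    lineDeriv 𝕜 (fun y => lineDeriv 𝕜 g y v) x w =
      lineDeriv 𝕜 (fun y => lineDeriv 𝕜 g y w) x v := by
  rw [lineDeriv_lineDeriv hg, lineDeriv_lineDeriv hg]
  have : IsSymmSndFDerivAt 𝕜 g x := hg.isSymmSndFDerivAt (by
    rw [minSmoothness_of_isRCLikeNormedField]
    exact ENat.LEInfty.out)
  exact this w v

theorem hasLineDerivAt_mul {f g : E → K} {f' g' : K} {x v : E} (hf : HasLineDerivAt 𝕜 f f' x v)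
    (hg : HasLineDerivAt 𝕜 g g' x v) :
    HasLineDerivAt 𝕜 (fun y => f y * g y) (f' * g x + f x * g') x v := by
  have h := HasDerivAt.fun_mul (𝕜 := 𝕜) (𝔸 := K) hf hg
  simp only [zero_smul, add_zero] at h
  exact h

theorem hasLineDerivAt_sum {ι : Type*} {T : Finset ι} {f : ι → E → V} {f' : ι → V} {x v : E}
    (hf : ∀ i ∈ T, HasLineDerivAt 𝕜 (f i) (f' i) x v) :
    HasLineDerivAt 𝕜 (fun y => ∑ i ∈ T, f i y) (∑ i ∈ T, f' i) x v :=
  HasDerivAt.fun_sum hf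

theorem hasLineDerivAt_add {f g : E → V} {f' g' : V} {x v : E} (hf : HasLineDerivAt 𝕜 f f' x v)
    (hg : HasLineDerivAt 𝕜 g g' x v) :
    HasLineDerivAt 𝕜 (fun y => f y + g y) (f' + g') x v :=
  HasDerivAt.fun_add hf hg

theorem hasLineDerivAt_sub {f g : E → V} {f' g' : V} {x v : E} (hf : HasLineDerivAt 𝕜 f f' x v)
    (hg : HasLineDerivAt 𝕜 g g' x v) :
    HasLineDerivAt 𝕜 (fun y => f y - g y) (f' - g') x v :=
  HasDerivAt.fun_sub hf hg

theorem hasLineDerivAt_const (a : V) (x v : E) : HasLineDerivAt 𝕜 (fun _ : E => a) 0 x v :=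
  hasDerivAt_const _ _

theorem hasLineDerivAt_const_mul (a : K) {f : E → K} {f' : K} {x v : E}
    (hf : HasLineDerivAt 𝕜 f f' x v) : HasLineDerivAt 𝕜 (fun y => a * f y) (a * f') x v := by
  simpa using hasLineDerivAt_mul (hasLineDerivAt_const (𝕜 := 𝕜) a x v) hf

theorem hasLineDerivAt_pi {ι : Type*} [Fintype ι] {f : E → ι → V} {f' : ι → V} {x v : E} :
    HasLineDerivAt 𝕜 f f' x v ↔ ∀ i, HasLineDerivAt 𝕜 (fun y => f y i) (f' i) x v :=
  hasDerivAt_pi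

end LineDeriv

/-! ### Evolution of the Taylor data and of the embedding operator -/

section Param

variable {𝕜 : Type*} [RCLike 𝕜] {K : Type*} [RCLike K] [NormedAlgebra 𝕜 K] {n N : ℕ}

section Chiral

variable {f₀ : 𝕜 → Fin (n + 1) → K} {U : Set (Times 𝕜 N)} {f : Times 𝕜 N → Fin (n + 1) → K}

theorem IsWParam.contDiffAt_iterate (hf : IsWParam f₀ U f) (s : ℕ) {z : Times 𝕜 N} (hz : z ∈ U) :
    ContDiffAt 𝕜 ∞ ((cd 1)^[s] f) z := by
  induction s generalizing z with
  | zero => exact hf.smooth.contDiffAt (hf.isOpen.mem_nhds hz)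
  | succ s ih =>
    rw [Function.iterate_succ_apply']
    exact contDiffAt_lineDeriv (ih hz) _

/-- The flow equations propagate to all `∂_1`-derivatives, because partial derivatives commute. -/
theorem IsWParam.cd_iterate (hf : IsWParam f₀ U f) {p : ℕ} (hp : p ≤ N) (s : ℕ) {z : Times 𝕜 N}
    (hz : z ∈ U) : cd p ((cd 1)^[s] f) z = (cd 1)^[s + p] f z := by
  induction s generalizing z with
  | zero => rw [zero_add]; exact hf.flow p hp z hz
  | succ s ih =>
    rw [Function.iterate_succ_apply', Nat.add_right_comm, Function.iterate_succ_apply']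
    have h : cd p ((cd 1)^[s] f) =ᶠ[𝓝 z] (cd 1)^[s + p] f := by
      filter_upwards [hf.isOpen.mem_nhds hz] with y hy using ih hy
    rw [cd, cd.eq_1 1 ((cd 1)^[s + p] f), ← h.lineDeriv_eq]
    exact lineDeriv_comm (hf.contDiffAt_iterate s hz) _ _

theorem IsWParam.cd_eq_taylor (hf : IsWParam f₀ U f) {p : ℕ} (hp : p ≤ N) {z : Times 𝕜 N}
    (hz : z ∈ U) (A : Fin (n + 1)) : cd p f z A = taylor f z A p := by
  rw [hf.flow p hp z hz, taylor]

theorem IsWParam.contDiffAt_taylor (hf : IsWParam f₀ U f) {z : Times 𝕜 N} (hz : z ∈ U)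
    (A : Fin (n + 1)) (s : ℕ) : ContDiffAt 𝕜 ∞ (fun y => taylor f y A s) z :=
  contDiffAt_pi.1 (hf.contDiffAt_iterate s hz) A

theorem IsWParam.hasLineDerivAt_taylor (hf : IsWParam f₀ U f) {p : ℕ} (hp : p ≤ N)
    {z : Times 𝕜 N} (hz : z ∈ U) (A : Fin (n + 1)) (s : ℕ) :
    HasLineDerivAt 𝕜 (fun y => taylor f y A s) (taylor f z A (s + p)) z (dir 𝕜 N p) := by
  have h := hasLineDerivAt_of_contDiffAt (hf.contDiffAt_iterate s hz) (dir 𝕜 N p)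
  have h2 : lineDeriv 𝕜 ((cd 1)^[s] f) z (dir 𝕜 N p) = (cd 1)^[s + p] f z :=
    hf.cd_iterate hp s hz
  rw [h2] at h
  exact hasLineDerivAt_pi.1 h A

end Chiral

variable {f₀ fb₀ : 𝕜 → Fin (n + 1) → K} {U Ub : Set (Times 𝕜 N)}
  {f fb : Times 𝕜 N → Fin (n + 1) → K} {x : Times 𝕜 N × Times 𝕜 N}

theorem hasLineDerivAt_swap {V : Type*} [NormedAddCommGroup V] [NormedSpace 𝕜 V]
    {g : Times 𝕜 N × Times 𝕜 N → V} {g' : V} {v : Times 𝕜 N × Times 𝕜 N}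
    (h : HasLineDerivAt 𝕜 g g' x.swap v.swap) :
    HasLineDerivAt 𝕜 (fun y => g y.swap) g' x v := h

theorem hasLineDerivAt_taylor_fst (hf : IsWParam f₀ U f) (hx : x.1 ∈ U) {p : ℕ} (hp : p ≤ N)
    (A : Fin (n + 1)) (s : ℕ) :
    HasLineDerivAt 𝕜 (fun y : Times 𝕜 N × Times 𝕜 N => taylor f y.1 A s)
      (taylor f x.1 A (s + p)) x (dirZ 𝕜 N p) :=
  hf.hasLineDerivAt_taylor hp hx A s

theorem hasLineDerivAt_taylor_snd (p : ℕ) (A : Fin (n + 1)) (s : ℕ) :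
    HasLineDerivAt 𝕜 (fun y : Times 𝕜 N × Times 𝕜 N => taylor fb y.2 A s) 0 x (dirZ 𝕜 N p) := by
  have h : HasLineDerivAt 𝕜 (fun y => taylor fb y A s) 0 x.2 0 := by
    simpa [HasLineDerivAt] using hasDerivAt_const (0 : 𝕜) (taylor fb x.2 A s)
  exact h

theorem contDiffAt_moment (hf : IsWParam f₀ U f) (hfb : IsWParam fb₀ Ub fb) (hx : x.1 ∈ U)
    (hxb : x.2 ∈ Ub) (i j : ℕ) :
    ContDiffAt 𝕜 ∞ (fun y : Times 𝕜 N × Times 𝕜 N =>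
      moment (taylor f y.1) (taylor fb y.2) i j) x :=
  ContDiffAt.sum fun A _ =>
    ((hf.contDiffAt_taylor hx A i).comp x contDiffAt_fst).mul
      ((hfb.contDiffAt_taylor hxb A j).comp x contDiffAt_snd)

theorem hasLineDerivAt_moment (hf : IsWParam f₀ U f) (hx : x.1 ∈ U) {p : ℕ} (hp : p ≤ N)
    (i j : ℕ) :
    HasLineDerivAt 𝕜 (fun y : Times 𝕜 N × Times 𝕜 N => moment (taylor f y.1) (taylor fb y.2) i j)
      (moment (taylor f x.1) (taylor fb x.2) (i + p) j) x (dirZ 𝕜 N p) := by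
  have := hasLineDerivAt_sum (T := Finset.univ) fun A _ =>
    hasLineDerivAt_mul (hasLineDerivAt_taylor_fst hf hx hp A i)
      (hasLineDerivAt_taylor_snd (fb := fb) p A j)
  simp only [mul_zero, add_zero] at this
  exact this

/-- The relation `𝒢 ψ⁺_t = ψ⁺_{η(t, ·)} 𝒢` as a finite sum whose range does not depend on the Taylor
data, so that it can be differentiated term by term. -/
theorem exists_embeddingForm_create (b : BraSpace K) :
    ∃ T : Finset ℕ, ∀ (c cb : Fin (n + 1) → ℕ → K) (t : ℕ) (k : KetSpace K),
      embeddingForm c cb b (create t k) =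
        ∑ j ∈ T, moment c cb t j * embeddingForm c cb (braCreate b j) k := by
  obtain ⟨T, -, hT⟩ := exists_annihSum_eq (rev b)
  refine ⟨T, fun c cb t k => ?_⟩
  have h : braCreateSum b (moment c cb t) = ∑ j ∈ T, moment c cb t j • braCreate b j := by
    rw [← rev_rev b, ← rev_annihSum, hT]
    simp only [rev, map_sum, map_smul]
    simp only [← rev_annih]
  rw [embeddingForm_create, h, embeddingForm_sum_left]
  simp only [embeddingForm_smul_left]

theorem contDiffAt_G (hf : IsWParam f₀ U f) (hfb : IsWParam fb₀ Ub fb) (hx : x.1 ∈ U)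
    (hxb : x.2 ∈ Ub) (b : BraSpace K) (k : KetSpace K) :
    ContDiffAt 𝕜 ∞ (fun y => G f fb y b k) x := by
  induction k using ket_induction generalizing b with
  | one => simp only [G, embeddingForm_one_right]; exact contDiffAt_const
  | add k k' h h' => simp only [G, embeddingForm_add]; exact (h b).add (h' b)
  | smul a k h => simp only [G, embeddingForm_smul]; exact contDiffAt_const.mul (h b)
  | create t k h =>
    obtain ⟨T, hT⟩ := exists_embeddingForm_create (n := n) b
    simp only [G, hT]
    exact ContDiffAt.sum fun j _ => (contDiffAt_moment hf hfb hx hxb t j).mul (h _)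

/-- `∂_p 𝒢 = 𝒢 J_p`. Both sides are generated from the vacuum by `𝒢 ψ⁺_t = ψ⁺_{η(t, ·)} 𝒢`, and
`∂_p η(t, j) = η(t + p, j)`. -/
theorem hasLineDerivAt_G (hf : IsWParam f₀ U f) (hx : x.1 ∈ U)
    {p : ℕ} (hp : p ≤ N) (b : BraSpace K) (k : KetSpace K) :
    HasLineDerivAt 𝕜 (fun y => G f fb y b k) (G f fb x b (current p k)) x (dirZ 𝕜 N p) := by
  induction k using ket_induction generalizing b with
  | one =>
    simp only [G, embeddingForm_one_right, current_one, embeddingForm_zero]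
    exact hasLineDerivAt_const _ _ _
  | add k k' h h' =>
    simp only [G, current_add, embeddingForm_add]
    exact hasLineDerivAt_add (h b) (h' b)
  | smul a k h =>
    simp only [G, current_smul, embeddingForm_smul]
    exact hasLineDerivAt_const_mul a (h b)
  | create t k h =>
    obtain ⟨T, hT⟩ := exists_embeddingForm_create (n := n) b
    have := hasLineDerivAt_sum (T := T) fun j _ =>
      hasLineDerivAt_mul (hasLineDerivAt_moment (fb := fb) hf hx hp t j) (h (braCreate b j))
    simp only [G, current_create, embeddingForm_add, hT, ← Finset.sum_add_distrib] at this ⊢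
    exact this

theorem G_swap (x : Times 𝕜 N × Times 𝕜 N) (b : BraSpace K) (k : KetSpace K) :
    G fb f x.swap (rev k) (rev b) = G f fb x b k := embeddingForm_swap _ _ _ _

/-- `∂̄_p 𝒢 = J̄_p 𝒢`. -/
theorem hasLineDerivAt_G_bar (hfb : IsWParam fb₀ Ub fb) (hxb : x.2 ∈ Ub)
    {p : ℕ} (hp : p ≤ N) (b : BraSpace K) (k : KetSpace K) :
    HasLineDerivAt 𝕜 (fun y => G f fb y b k) (G f fb x (braCurrent p b) k) x (dirZbar 𝕜 N p) := by
  rw [show (fun y => G f fb y b k) = fun y => G fb f y.swap (rev k) (rev b) from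
    funext fun y => (G_swap y b k).symm, ← G_swap, rev_braCurrent]
  exact hasLineDerivAt_swap (g := fun y => G fb f y (rev k) (rev b))
    (hasLineDerivAt_G (x := x.swap) hfb hxb hp _ _)

/-! ### The moving frame -/

theorem tau_eq (l : ℕ) (x : Times 𝕜 N × Times 𝕜 N) :
    tau f fb l x = tauAt (taylor f x.1) (taylor fb x.2) l := rfl

theorem tauAt_bar (l : ℕ) (x : Times 𝕜 N × Times 𝕜 N) :
    tauAt (taylor fb x.2) (taylor f x.1) l = tau f fb l x := tauAt_swap _ _ _

theorem tau_swap (l : ℕ) (x : Times 𝕜 N × Times 𝕜 N) : tau fb f l x.swap = tau f fb l x :=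
  tauAt_swap _ _ _

theorem eta_eq (hf : IsWParam f₀ U f) (hfb : IsWParam fb₀ Ub fb) (hx : x.1 ∈ U) (hxb : x.2 ∈ Ub)
    {i j : ℕ} (hi : i ≤ N) (hj : j ≤ N) :
    eta f fb i j x = moment (taylor f x.1) (taylor fb x.2) i j := by
  simp only [eta, moment, hf.cd_eq_taylor hi hx, hfb.cd_eq_taylor hj hxb]

theorem v_eq (hf : IsWParam f₀ U f) (hfb : IsWParam fb₀ Ub fb) (hx : x.1 ∈ U) (hxb : x.2 ∈ Ub)
    {l : ℕ} (hl : l ≤ N) : v f fb l x = frame (taylor f x.1) (taylor fb x.2) l := by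
  ext A
  rw [v, frame_eq_det]
  congr 1
  ext r s
  simp only [Matrix.of_apply]
  rw [eta_eq hf hfb hx hxb (by omega) (by omega), hf.cd_eq_taylor (by omega) hx]

theorem vb_eq (hf : IsWParam f₀ U f) (hfb : IsWParam fb₀ Ub fb) (hx : x.1 ∈ U) (hxb : x.2 ∈ Ub)
    {l : ℕ} (hl : l ≤ N) : vb f fb l x = frame (taylor fb x.2) (taylor f x.1) l := by
  ext A
  rw [vb, frame_eq_det]
  congr 1
  ext r s
  simp only [Matrix.of_apply]
  rw [eta_eq hf hfb hx hxb (by omega) (by omega), hfb.cd_eq_taylor (by omega) hxb, moment_swap]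

theorem finsum_eq_sum_range_of_lt {g : ℕ → K} {l : ℕ} (h : ∀ s, l < s → g s = 0) :
    ∑ᶠ s, g s = ∑ s ∈ Finset.range (l + 1), g s :=
  finsum_eq_sum_of_support_subset _ fun s hs => by
    by_contra hs'
    rw [Finset.mem_coe, Finset.mem_range, not_lt] at hs'
    exact hs (h s hs')

theorem Fmat_eq (p : ℕ) (x : Times 𝕜 N × Times 𝕜 N) (l m : ℕ) :
    Fmat f fb p x l m = shiftCoef (taylor f x.1) (taylor fb x.2) p l m := by
  have h : ∀ s, G f fb x (bra K (m + 1)) (create (s + p) (ket K m)) *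
      G f fb x (bra K l) (annih s (ket K (l + 1))) =
      coef (taylor f x.1) (taylor fb x.2) l s *
        polyPair (taylor fb x.2) (taylor f x.1) m (s + p) := by
    intro s
    rw [polyPair_swap, mul_comm, coef, G, G]
  rw [Fmat, shiftCoef, finsum_congr h, finsum_eq_sum_range_of_lt (l := l)]
  · rfl
  · intro s hs
    rw [coef_eq_zero _ _ hs, zero_mul]

theorem Gmat_eq (p : ℕ) (x : Times 𝕜 N × Times 𝕜 N) (m l : ℕ) :
    Gmat f fb p x m l = shiftCoef (taylor fb x.2) (taylor f x.1) p l m := by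
  refine Eq.trans ?_ (Fmat_eq (f := fb) (fb := f) p x.swap l m)
  rw [Fmat, Gmat, tau_swap, tau_swap]
  congr 1
  refine finsum_congr fun s => ?_
  rw [← G_swap, ← G_swap (k := ket K (m + 1)), mul_comm]
  simp only [rev_braAnnih, rev_braCreate, rev_ket, rev_bra]

theorem ketV_eq (l : ℕ) (x : Times 𝕜 N × Times 𝕜 N) :
    ketV f fb l x = ∑ s ∈ Finset.range (l + 1),
      coef (taylor f x.1) (taylor fb x.2) l s • create s (ket K 0) := rfl

theorem braV_eq (l : ℕ) (x : Times 𝕜 N × Times 𝕜 N) :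
    braV f fb l x = ∑ s ∈ Finset.range (l + 1),
      coef (taylor fb x.2) (taylor f x.1) l s • braAnnih (bra K 0) s := by
  simp only [coef_swap]; rfl

theorem rev_braV (l : ℕ) (x : Times 𝕜 N × Times 𝕜 N) :
    rev (braV f fb l x) = ketV fb f l x.swap := by
  rw [braV_eq, ketV_eq]
  simp only [rev, map_sum, map_smul]
  refine Finset.sum_congr rfl fun s _ => ?_
  rw [show (CliffordAlgebra.reverse (braAnnih (bra K 0) s) : KetSpace K) =
    create s (rev (bra K 0)) from rev_braAnnih _ _, rev_bra]
  rfl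

theorem Fmat_eq_current (p l m : ℕ) (x : Times 𝕜 N × Times 𝕜 N) :
    Fmat f fb p x l m = (tau f fb m x * tau f fb (m + 1) x)⁻¹ *
      G f fb x (braV f fb m x) ((current 1)^[p] (ketV f fb l x)) := by
  rw [Fmat_eq, braV_eq, ketV_eq, G, embeddingForm_current_iterate]; rfl

theorem Gmat_eq_current (p l m : ℕ) (x : Times 𝕜 N × Times 𝕜 N) :
    Gmat f fb p x m l = (tau f fb m x * tau f fb (m + 1) x)⁻¹ *
      G f fb x ((braCurrent 1)^[p] (braV f fb l x)) (ketV f fb m x) := by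
  have hrev : ∀ b : BraSpace K, rev ((braCurrent 1)^[p] b) = (current 1)^[p] (rev b) := by
    intro b
    induction p with
    | zero => rfl
    | succ p ih => rw [Function.iterate_succ_apply', rev_braCurrent, ih,
        Function.iterate_succ_apply']
  have hk : rev (ketV f fb m x) = braV fb f m x.swap := by
    rw [← rev_rev (braV fb f m x.swap), rev_braV, Prod.swap_swap]
  rw [← G_swap, hrev, rev_braV, hk, ← tau_swap, ← tau_swap (m + 1), ← Fmat_eq_current, Fmat_eq,
    Gmat_eq]
  rfl

end Param

/-! ### The Frenet–Serret equations -/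

section Param

variable {𝕜 : Type*} [RCLike 𝕜] {K : Type*} [RCLike K] [NormedAlgebra 𝕜 K] {n N : ℕ}
variable {f₀ fb₀ : 𝕜 → Fin (n + 1) → K} {U Ub : Set (Times 𝕜 N)}
  {f fb : Times 𝕜 N → Fin (n + 1) → K} {x : Times 𝕜 N × Times 𝕜 N}

/-- The points at which the moving frame is defined: both chiral parameters lie in the domains of
the embedding functions and the tau-functions do not vanish. -/
def regular (f fb : Times 𝕜 N → Fin (n + 1) → K) (U Ub : Set (Times 𝕜 N)) :
    Set (Times 𝕜 N × Times 𝕜 N) :=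
  {x | x.1 ∈ U ∧ x.2 ∈ Ub ∧ ∀ l ≤ n + 1, tau f fb l x ≠ 0}

theorem regular_swap (h : x ∈ regular f fb U Ub) : x.swap ∈ regular fb f Ub U :=
  ⟨h.2.1, h.1, fun l hl => by rw [tau_swap]; exact h.2.2 l hl⟩

theorem eventually_mem_prod (hf : IsWParam f₀ U f) (hfb : IsWParam fb₀ Ub fb) (hx : x.1 ∈ U)
    (hxb : x.2 ∈ Ub) : ∀ᶠ y in 𝓝 x, y.1 ∈ U ∧ y.2 ∈ Ub :=
  (hf.isOpen.prod hfb.isOpen).mem_nhds ⟨hx, hxb⟩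

theorem eventually_regular (hf : IsWParam f₀ U f) (hfb : IsWParam fb₀ Ub fb)
    (h : x ∈ regular f fb U Ub) : ∀ᶠ y in 𝓝 x, y ∈ regular f fb U Ub := by
  have h2 : ∀ᶠ y in 𝓝 x, ∀ l ∈ Finset.range (n + 2), tau f fb l y ≠ 0 := by
    rw [Finset.eventually_all]
    intro l hl
    exact (contDiffAt_G hf hfb h.1 h.2.1 _ _).continuousAt.eventually_ne
      (h.2.2 l (by rw [Finset.mem_range] at hl; omega))
  filter_upwards [eventually_mem_prod hf hfb h.1 h.2.1, h2] with y hy hy2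
  exact ⟨hy.1, hy.2, fun l hl => hy2 l (by rw [Finset.mem_range]; omega)⟩

theorem contDiffAt_tau (hf : IsWParam f₀ U f) (hfb : IsWParam fb₀ Ub fb) (hx : x.1 ∈ U)
    (hxb : x.2 ∈ Ub) (l : ℕ) : ContDiffAt 𝕜 ∞ (tau f fb l) x := contDiffAt_G hf hfb hx hxb _ _

theorem contDiffAt_coef (hf : IsWParam f₀ U f) (hfb : IsWParam fb₀ Ub fb) (hx : x.1 ∈ U)
    (hxb : x.2 ∈ Ub) (l s : ℕ) :
    ContDiffAt 𝕜 ∞ (fun y : Times 𝕜 N × Times 𝕜 N =>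
      coef (taylor f y.1) (taylor fb y.2) l s) x := contDiffAt_G hf hfb hx hxb _ _

theorem contDiffAt_coef_swap (hf : IsWParam f₀ U f) (hfb : IsWParam fb₀ Ub fb) (hx : x.1 ∈ U)
    (hxb : x.2 ∈ Ub) (l s : ℕ) :
    ContDiffAt 𝕜 ∞ (fun y : Times 𝕜 N × Times 𝕜 N =>
      coef (taylor fb y.2) (taylor f y.1) l s) x := by
  simp only [coef_swap]
  exact contDiffAt_G hf hfb hx hxb _ _

theorem contDiffAt_inv {g : Times 𝕜 N × Times 𝕜 N → K} (hg : ContDiffAt 𝕜 ∞ g x) (h : g x ≠ 0) :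
    ContDiffAt 𝕜 ∞ (fun y => (g y)⁻¹) x := hg.inv h

theorem contDiffAt_shiftCoef (hf : IsWParam f₀ U f) (hfb : IsWParam fb₀ Ub fb)
    (h : x ∈ regular f fb U Ub) (p l : ℕ) {m : ℕ} (hm : m ≤ n) :
    ContDiffAt 𝕜 ∞ (fun y : Times 𝕜 N × Times 𝕜 N =>
      shiftCoef (taylor f y.1) (taylor fb y.2) p l m) x := by
  refine (contDiffAt_inv ((contDiffAt_tau hf hfb h.1 h.2.1 m).mul
    (contDiffAt_tau hf hfb h.1 h.2.1 (m + 1)))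
      (mul_ne_zero (h.2.2 m (by omega)) (h.2.2 (m + 1) (by omega)))).mul ?_
  refine ContDiffAt.sum fun s _ => (contDiffAt_coef hf hfb h.1 h.2.1 l s).mul ?_
  simp only [polyPair, moment_swap]
  exact ContDiffAt.sum fun t _ => (contDiffAt_coef_swap hf hfb h.1 h.2.1 m t).mul
    (contDiffAt_moment hf hfb h.1 h.2.1 _ _)

theorem contDiffAt_Fmat (hf : IsWParam f₀ U f) (hfb : IsWParam fb₀ Ub fb)
    (h : x ∈ regular f fb U Ub) (p l : ℕ) {m : ℕ} (hm : m ≤ n) :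
    ContDiffAt 𝕜 ∞ (fun y => Fmat f fb p y l m) x := by
  simp only [Fmat_eq]
  exact contDiffAt_shiftCoef hf hfb h p l hm

theorem contDiffAt_comp_swap {V : Type*} [NormedAddCommGroup V] [NormedSpace 𝕜 V]
    {g : Times 𝕜 N × Times 𝕜 N → V} (hg : ContDiffAt 𝕜 ∞ g x.swap) :
    ContDiffAt 𝕜 ∞ (fun y => g y.swap) x :=
  ContDiffAt.comp x (f := Prod.swap) hg (contDiff_snd.prodMk contDiff_fst).contDiffAt

theorem contDiffAt_Gmat (hf : IsWParam f₀ U f) (hfb : IsWParam fb₀ Ub fb)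
    (h : x ∈ regular f fb U Ub) (p l : ℕ) {m : ℕ} (hm : m ≤ n) :
    ContDiffAt 𝕜 ∞ (fun y => Gmat f fb p y m l) x := by
  simp only [Gmat_eq]
  exact contDiffAt_comp_swap (g := fun y => shiftCoef (taylor fb y.1) (taylor f y.2) p l m)
    (contDiffAt_shiftCoef hfb hf (regular_swap h) p l hm)

theorem u_apply (hf : IsWParam f₀ U f) (hfb : IsWParam fb₀ Ub fb) (hx : x.1 ∈ U)
    (hxb : x.2 ∈ Ub) {l : ℕ} (hl : l ≤ N) (A : Fin (n + 1)) :
    u f fb l x A = (tau f fb l x)⁻¹ * frame (taylor f x.1) (taylor fb x.2) l A := by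
  rw [u, v_eq hf hfb hx hxb hl]; rfl

theorem ub_apply (hf : IsWParam f₀ U f) (hfb : IsWParam fb₀ Ub fb) (hx : x.1 ∈ U)
    (hxb : x.2 ∈ Ub) {l : ℕ} (hl : l ≤ N) (A : Fin (n + 1)) :
    ub f fb l x A = (tau f fb (l + 1) x)⁻¹ * frame (taylor fb x.2) (taylor f x.1) l A := by
  rw [ub, vb_eq hf hfb hx hxb hl]; rfl

theorem sum_ub_mul_u (hf : IsWParam f₀ U f) (hfb : IsWParam fb₀ Ub fb)
    (h : x ∈ regular f fb U Ub) (hnN : n ≤ N) {l m : ℕ} (hl : l ≤ n) (hm : m ≤ n) :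
    ∑ A, ub f fb l x A * u f fb m x A = if l = m then 1 else 0 := by
  have h1 : ∑ A, ub f fb l x A * u f fb m x A = (tau f fb (l + 1) x)⁻¹ * (tau f fb m x)⁻¹ *
      ∑ A, frame (taylor f x.1) (taylor fb x.2) m A *
        frame (taylor fb x.2) (taylor f x.1) l A := by
    rw [Finset.mul_sum]
    refine Finset.sum_congr rfl fun A _ => ?_
    rw [u_apply hf hfb h.1 h.2.1 (hm.trans hnN), ub_apply hf hfb h.1 h.2.1 (hl.trans hnN)]
    ring
  rw [h1, sum_frame_mul_frame]
  by_cases hlm : l = m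
  · subst hlm
    have h2 := h.2.2 l (by omega)
    have h3 := h.2.2 (l + 1) (by omega)
    rw [if_pos rfl, if_pos rfl, ← tau_eq, ← tau_eq]
    field_simp
  · rw [if_neg hlm, if_neg (Ne.symm hlm), mul_zero]

theorem contDiffAt_frame (hf : IsWParam f₀ U f) (hfb : IsWParam fb₀ Ub fb) (hx : x.1 ∈ U)
    (hxb : x.2 ∈ Ub) (l : ℕ) (A : Fin (n + 1)) :
    ContDiffAt 𝕜 ∞ (fun y : Times 𝕜 N × Times 𝕜 N =>
      frame (taylor f y.1) (taylor fb y.2) l A) x :=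
  ContDiffAt.sum fun s _ => (contDiffAt_coef hf hfb hx hxb l s).mul
    ((hf.contDiffAt_taylor hx A s).comp x contDiffAt_fst)

theorem contDiffAt_u (hf : IsWParam f₀ U f) (hfb : IsWParam fb₀ Ub fb)
    (h : x ∈ regular f fb U Ub) (hnN : n ≤ N) {l : ℕ} (hl : l ≤ n) (A : Fin (n + 1)) :
    ContDiffAt 𝕜 ∞ (fun y => u f fb l y A) x := by
  refine ContDiffAt.congr_of_eventuallyEq ((contDiffAt_inv (contDiffAt_tau hf hfb h.1 h.2.1 l)
    (h.2.2 l (by omega))).mul (contDiffAt_frame hf hfb h.1 h.2.1 l A)) ?_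
  filter_upwards [eventually_mem_prod hf hfb h.1 h.2.1] with y hy
    using u_apply hf hfb hy.1 hy.2 (hl.trans hnN) A

theorem contDiffAt_ub (hf : IsWParam f₀ U f) (hfb : IsWParam fb₀ Ub fb)
    (h : x ∈ regular f fb U Ub) (hnN : n ≤ N) {l : ℕ} (hl : l ≤ n) (A : Fin (n + 1)) :
    ContDiffAt 𝕜 ∞ (fun y => ub f fb l y A) x := by
  refine ContDiffAt.congr_of_eventuallyEq
    ((contDiffAt_inv (contDiffAt_tau hf hfb h.1 h.2.1 (l + 1)) (h.2.2 (l + 1) (by omega))).mul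
      (contDiffAt_comp_swap (g := fun y => frame (taylor fb y.1) (taylor f y.2) l A)
        (contDiffAt_frame hfb hf h.2.1 h.1 l A))) ?_
  filter_upwards [eventually_mem_prod hf hfb h.1 h.2.1] with y hy
    using ub_apply hf hfb hy.1 hy.2 (hl.trans hnN) A

/-- The derivative `w` of `ũ_ℓ` in a direction along which the Taylor data `c`, `c̄` change by
`δ` and `δb`, paired with the dual frame. The monic polynomial `P_ℓ / τ_ℓ` changes only in degrees
below `ℓ`, so for `m ≥ ℓ` only the change of `c` contributes; for `m < ℓ` the pairing follows from
differentiating the orthogonality of `P_ℓ` to `Y^t`, `t ≤ m`. -/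
theorem hasLineDerivAt_u_aux (hf : IsWParam f₀ U f) (hfb : IsWParam fb₀ Ub fb)
    (h : x ∈ regular f fb U Ub) (hnN : n ≤ N) {l : ℕ} (hl : l ≤ n)
    (e : Times 𝕜 N × Times 𝕜 N) (δ δb : Fin (n + 1) → ℕ → K)
    (hδ : ∀ A s, HasLineDerivAt 𝕜 (fun y : Times 𝕜 N × Times 𝕜 N => taylor f y.1 A s) (δ A s) x e)
    (hδb : ∀ A s, HasLineDerivAt 𝕜 (fun y : Times 𝕜 N × Times 𝕜 N => taylor fb y.2 A s)
      (δb A s) x e) :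
    ∃ w : Fin (n + 1) → K, HasLineDerivAt 𝕜 (u f fb l) w x e ∧ ∀ m ≤ n,
      ∑ B, w B * frame (taylor fb x.2) (taylor f x.1) m B =
        if l ≤ m then (tau f fb l x)⁻¹ * ∑ B, (∑ s ∈ Finset.range (l + 1),
          coef (taylor f x.1) (taylor fb x.2) l s * δ B s) *
            frame (taylor fb x.2) (taylor f x.1) m B
        else -∑ t ∈ Finset.range (m + 1), coef (taylor fb x.2) (taylor f x.1) m t *
          ∑ B, u f fb l x B * δb B t := by
  have hlN := hl.trans hnN
  have hev := eventually_regular hf hfb h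
  let a : ℕ → Times 𝕜 N × Times 𝕜 N → K := fun s y =>
    (tau f fb l y)⁻¹ * coef (taylor f y.1) (taylor fb y.2) l s
  have ha : ∀ s, ContDiffAt 𝕜 ∞ (a s) x := fun s =>
    (contDiffAt_inv (contDiffAt_tau hf hfb h.1 h.2.1 l) (h.2.2 l (by omega))).mul
      (contDiffAt_coef hf hfb h.1 h.2.1 l s)
  -- the leading coefficient of the monic polynomial `P_ℓ / τ_ℓ` is constant, whence `hal` below
  let a' : ℕ → K := fun s => lineDeriv 𝕜 (a s) x e
  have ha' : ∀ s, HasLineDerivAt 𝕜 (a s) (a' s) x e := fun s =>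
    hasLineDerivAt_of_contDiffAt (ha s) e
  have hal : a' l = 0 := by
    have h1 : a l =ᶠ[𝓝 x] fun _ => 1 := by
      filter_upwards [hev] with y hy
      change (tau f fb l y)⁻¹ * _ = _
      rw [coef_self, ← tau_eq, inv_mul_cancel₀ (hy.2.2 l (by omega))]
    exact h1.lineDeriv_eq.trans (hasLineDerivAt_const (𝕜 := 𝕜) (1 : K) x e).lineDeriv
  let w : Fin (n + 1) → K := fun A => ∑ s ∈ Finset.range (l + 1),
    (a' s * taylor f x.1 A s + a s x * δ A s)
  have hw : HasLineDerivAt 𝕜 (u f fb l) w x e := by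
    rw [hasLineDerivAt_pi]
    intro A
    refine (hasLineDerivAt_sum fun s _ => hasLineDerivAt_mul (ha' s) (hδ A s)).congr_of_eventuallyEq
      ?_
    filter_upwards [eventually_mem_prod hf hfb h.1 h.2.1] with y hy
    rw [u_apply hf hfb hy.1 hy.2 hlN, frame, Finset.mul_sum]
    exact Finset.sum_congr rfl fun _ _ => (mul_assoc _ _ _).symm
  refine ⟨w, hw, fun m hm => ?_⟩
  split_ifs with hlm
  · have h1 : ∀ B, w B * frame (taylor fb x.2) (taylor f x.1) m B =
        ∑ s ∈ Finset.range (l + 1),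
          a' s * (frame (taylor fb x.2) (taylor f x.1) m B * taylor f x.1 B s) +
        (tau f fb l x)⁻¹ * ((∑ s ∈ Finset.range (l + 1),
          coef (taylor f x.1) (taylor fb x.2) l s * δ B s) *
            frame (taylor fb x.2) (taylor f x.1) m B) := by
      intro B
      simp only [w, a, Finset.sum_mul, Finset.mul_sum, ← Finset.sum_add_distrib]
      exact Finset.sum_congr rfl fun _ _ => by ring
    rw [Finset.sum_congr rfl fun B _ => h1 B, Finset.sum_add_distrib, ← Finset.mul_sum,
      Finset.sum_comm, add_eq_right]
    refine Finset.sum_eq_zero fun s hs => ?_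
    rw [← Finset.mul_sum, sum_frame_mul]
    rcases (Nat.lt_succ_iff_lt_or_eq.1 (Finset.mem_range.1 hs)) with hs | rfl
    · rw [polyPair_of_lt _ _ (by omega), mul_zero]
    · rw [hal, zero_mul]
  · rw [not_le] at hlm
    have h1 : ∀ t ∈ Finset.range (m + 1),
        ∑ B, w B * taylor fb x.2 B t = -∑ B, u f fb l x B * δb B t := by
      intro t ht
      have h2 : HasLineDerivAt 𝕜 (fun y => ∑ B, u f fb l y B * taylor fb y.2 B t)
          (∑ B, (w B * taylor fb x.2 B t + u f fb l x B * δb B t)) x e :=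
        hasLineDerivAt_sum fun B _ => hasLineDerivAt_mul (hasLineDerivAt_pi.1 hw B) (hδb B t)
      have h3 : (fun y => ∑ B, u f fb l y B * taylor fb y.2 B t) =ᶠ[𝓝 x] fun _ => 0 := by
        filter_upwards [eventually_mem_prod hf hfb h.1 h.2.1] with y hy
        simp only [u_apply hf hfb hy.1 hy.2 hlN, mul_assoc, ← Finset.mul_sum]
        rw [sum_frame_mul, polyPair_of_lt _ _ (by rw [Finset.mem_range] at ht; omega), mul_zero]
      have h4 := h2.unique ((hasLineDerivAt_const (𝕜 := 𝕜) (0 : K) x e).congr_of_eventuallyEq h3)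
      rw [Finset.sum_add_distrib] at h4
      exact eq_neg_of_add_eq_zero_left h4
    rw [← Finset.sum_neg_distrib]
    simp only [← mul_neg]
    rw [← Finset.sum_congr rfl fun t ht => congrArg _ (h1 t ht)]
    simp only [frame, Finset.mul_sum]
    rw [Finset.sum_comm]
    exact Finset.sum_congr rfl fun _ _ => Finset.sum_congr rfl fun _ _ => by ring

/-- Expansion of a vector in the basis `ũ_m`. -/
theorem expand_u (hf : IsWParam f₀ U f) (hfb : IsWParam fb₀ Ub fb)
    (h : x ∈ regular f fb U Ub) (hnN : n ≤ N) (w : Fin (n + 1) → K) :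
    w = ∑ m ∈ Finset.range (n + 1), ((tau f fb (m + 1) x)⁻¹ *
      ∑ B, w B * frame (taylor fb x.2) (taylor f x.1) m B) • u f fb m x := by
  ext A
  rw [Finset.sum_apply]
  refine (frame_expansion h.2.2 w A).trans (Finset.sum_congr rfl fun m hm => ?_)
  rw [Finset.mem_range] at hm
  rw [Pi.smul_apply, u_apply hf hfb h.1 h.2.1 (by omega), smul_eq_mul, mul_inv, tau_eq, tau_eq]
  ring

theorem laxZ_apply (p : ℕ) (x : Times 𝕜 N × Times 𝕜 N) (i j : Fin (n + 1)) :
    laxZ f fb p x i j = if (i : ℕ) ≤ j then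
      (tau f fb i x)⁻¹ * Fmat f fb p x i j * tau f fb j x else 0 := by
  rw [laxZ, Matrix.mul_diagonal, Matrix.diagonal_mul, upper, Matrix.of_apply, Fm, Matrix.of_apply]
  by_cases hij : (i : ℕ) ≤ j
  · rw [if_pos hij, if_pos (Fin.le_def.2 hij)]
  · rw [if_neg hij, if_neg fun h => hij (Fin.le_def.1 h), mul_zero, zero_mul]

theorem laxZbar_apply (p : ℕ) (x : Times 𝕜 N × Times 𝕜 N) (i j : Fin (n + 1)) :
    laxZbar f fb p x i j = if (j : ℕ) < i then
      -(tau f fb (i + 1) x * Gmat f fb p x i j * (tau f fb (j + 1) x)⁻¹) else 0 := by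
  rw [laxZbar, Matrix.neg_apply, Matrix.mul_diagonal, Matrix.diagonal_mul, lower, Matrix.of_apply,
    Gm, Matrix.of_apply]
  by_cases hij : (j : ℕ) < i
  · rw [if_pos hij, if_pos (Fin.lt_def.2 hij)]
  · rw [if_neg hij, if_neg fun h => hij (Fin.lt_def.1 h), mul_zero, zero_mul, neg_zero]

theorem hasLineDerivAt_u (hf : IsWParam f₀ U f) (hfb : IsWParam fb₀ Ub fb)
    (h : x ∈ regular f fb U Ub) (hnN : n ≤ N) {p : ℕ} (hp : p ≤ N) (l : Fin (n + 1)) :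
    HasLineDerivAt 𝕜 (u f fb l) (∑ m : Fin (n + 1), laxZ f fb p x l m • u f fb m x) x
      (dirZ 𝕜 N p) := by
  obtain ⟨w, hw, hw2⟩ := hasLineDerivAt_u_aux hf hfb h hnN (Nat.lt_succ_iff.1 l.2) (dirZ 𝕜 N p)
    (fun A s => taylor f x.1 A (s + p)) 0 (fun A s => hasLineDerivAt_taylor_fst hf h.1 hp A s)
    (fun A s => hasLineDerivAt_taylor_snd p A s)
  convert hw using 1
  rw [expand_u hf hfb h hnN w, ← Fin.sum_univ_eq_sum_range fun m => ((tau f fb (m + 1) x)⁻¹ *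
      ∑ B, w B * frame (taylor fb x.2) (taylor f x.1) m B) • u f fb m x]
  refine Finset.sum_congr rfl fun m _ => ?_
  congr 1
  rw [hw2 m (Nat.lt_succ_iff.1 m.2), laxZ_apply]
  split_ifs with hlm
  · have h1 := h.2.2 m (by omega)
    rw [sum_shift_mul_frame, Fmat_eq, shiftCoef, ← tau_eq, ← tau_eq]
    field_simp
  · simp

theorem hasLineDerivAt_u_bar (hf : IsWParam f₀ U f) (hfb : IsWParam fb₀ Ub fb)
    (h : x ∈ regular f fb U Ub) (hnN : n ≤ N) {p : ℕ} (hp : p ≤ N) (l : Fin (n + 1)) :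
    HasLineDerivAt 𝕜 (u f fb l) (∑ m : Fin (n + 1), laxZbar f fb p x l m • u f fb m x) x
      (dirZbar 𝕜 N p) := by
  obtain ⟨w, hw, hw2⟩ := hasLineDerivAt_u_aux hf hfb h hnN (Nat.lt_succ_iff.1 l.2) (dirZbar 𝕜 N p)
    0 (fun A s => taylor fb x.2 A (s + p))
    (fun A s => hasLineDerivAt_swap (x := x) (v := dirZbar 𝕜 N p)
      (g := fun y : Times 𝕜 N × Times 𝕜 N => taylor f y.2 A s)
      (hasLineDerivAt_taylor_snd (x := x.swap) p A s))
    (fun A s => hasLineDerivAt_swap (x := x) (v := dirZbar 𝕜 N p)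
      (g := fun y : Times 𝕜 N × Times 𝕜 N => taylor fb y.1 A s)
      (hasLineDerivAt_taylor_fst (x := x.swap) hfb h.2.1 hp A s))
  convert hw using 1
  rw [expand_u hf hfb h hnN w, ← Fin.sum_univ_eq_sum_range fun m => ((tau f fb (m + 1) x)⁻¹ *
      ∑ B, w B * frame (taylor fb x.2) (taylor f x.1) m B) • u f fb m x]
  refine Finset.sum_congr rfl fun m _ => ?_
  congr 1
  rw [hw2 m (Nat.lt_succ_iff.1 m.2), laxZbar_apply]
  by_cases hlm : (m : ℕ) < l
  · rw [if_pos hlm, if_neg (not_le.2 hlm)]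
    have h1 := h.2.2 l (by omega)
    have h2 := h.2.2 (l + 1) (by omega)
    have h3 : ∀ t, ∑ B, u f fb l x B * taylor fb x.2 B (t + p) =
        (tau f fb l x)⁻¹ * polyPair (taylor f x.1) (taylor fb x.2) l (t + p) := by
      intro t
      rw [← sum_frame_mul, Finset.mul_sum]
      exact Finset.sum_congr rfl fun B _ => by
        rw [u_apply hf hfb h.1 h.2.1 (by omega), mul_assoc]
    have h4 : ∑ t ∈ Finset.range ((m : ℕ) + 1), coef (taylor fb x.2) (taylor f x.1) m t *
          ∑ B, u f fb l x B * taylor fb x.2 B (t + p) =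
        (tau f fb l x)⁻¹ * shiftPair (taylor fb x.2) (taylor f x.1) p m l := by
      rw [shiftPair, Finset.mul_sum]
      exact Finset.sum_congr rfl fun t _ => by rw [h3]; ring
    rw [h4, Gmat_eq, shiftCoef, tauAt_bar, tauAt_bar]
    field_simp
  · rw [if_neg hlm, if_pos (not_lt.1 hlm)]
    simp

/-- The equations of the dual frame follow from those of the frame by differentiating the
duality relation. -/
theorem hasLineDerivAt_ub_of_u (hf : IsWParam f₀ U f) (hfb : IsWParam fb₀ Ub fb)
    (h : x ∈ regular f fb U Ub) (hnN : n ≤ N) (e : Times 𝕜 N × Times 𝕜 N)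
    (M : Matrix (Fin (n + 1)) (Fin (n + 1)) K)
    (hM : ∀ l : Fin (n + 1),
      HasLineDerivAt 𝕜 (u f fb l) (∑ m : Fin (n + 1), M l m • u f fb m x) x e)
    (l : Fin (n + 1)) :
    HasLineDerivAt 𝕜 (ub f fb l) (-∑ m : Fin (n + 1), M m l • ub f fb m x) x e := by
  have hd : HasLineDerivAt 𝕜 (ub f fb l) (lineDeriv 𝕜 (ub f fb l) x e) x e :=
    hasLineDerivAt_of_contDiffAt
      (contDiffAt_pi.2 (contDiffAt_ub hf hfb h hnN (Nat.lt_succ_iff.1 l.2))) e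
  set w := lineDeriv 𝕜 (ub f fb l) x e
  have hpair : ∀ m : Fin (n + 1), ∑ B, w B * u f fb m x B = -M m l := by
    intro m
    have h1 : HasLineDerivAt 𝕜 (fun y => ∑ B, ub f fb l y B * u f fb m y B)
        (∑ B, (w B * u f fb m x B + ub f fb l x B * (∑ j : Fin (n + 1), M m j • u f fb j x) B))
        x e :=
      hasLineDerivAt_sum fun B _ =>
        hasLineDerivAt_mul (hasLineDerivAt_pi.1 hd B) (hasLineDerivAt_pi.1 (hM m) B)
    have h2 : (fun y => ∑ B, ub f fb l y B * u f fb m y B) =ᶠ[𝓝 x]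
        fun _ => if (l : ℕ) = m then 1 else 0 := by
      filter_upwards [eventually_regular hf hfb h] with y hy
      exact sum_ub_mul_u hf hfb hy hnN (Nat.lt_succ_iff.1 l.2) (Nat.lt_succ_iff.1 m.2)
    have h3 := h1.unique ((hasLineDerivAt_const (𝕜 := 𝕜) (if (l : ℕ) = m then (1 : K) else 0)
      x e).congr_of_eventuallyEq h2)
    have h4 : ∑ B, ub f fb l x B * (∑ j : Fin (n + 1), M m j • u f fb j x) B = M m l := by
      have h5 : ∀ j : Fin (n + 1), ∑ B, M m j * (ub f fb l x B * u f fb j x B) =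
          if l = j then M m j else 0 := by
        intro j
        rw [← Finset.mul_sum, sum_ub_mul_u hf hfb h hnN (Nat.lt_succ_iff.1 l.2)
          (Nat.lt_succ_iff.1 j.2)]
        simp [Fin.ext_iff]
      simp only [Finset.sum_apply, Pi.smul_apply, smul_eq_mul, Finset.mul_sum]
      rw [Finset.sum_comm]
      simp only [mul_left_comm (ub f fb l x _), h5, Finset.sum_ite_eq, Finset.mem_univ, if_true]
    rw [Finset.sum_add_distrib, h4] at h3
    exact eq_neg_of_add_eq_zero_left h3
  convert hd using 1
  ext A
  have hexp := frame_expansion (c := taylor fb x.2) (cb := taylor f x.1)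
    (fun j hj => by rw [tauAt_swap]; exact h.2.2 j hj) w A
  rw [hexp, ← Fin.sum_univ_eq_sum_range fun m => ((tauAt (taylor fb x.2) (taylor f x.1) m *
    tauAt (taylor fb x.2) (taylor f x.1) (m + 1))⁻¹ *
      ∑ B, w B * frame (taylor f x.1) (taylor fb x.2) m B) *
        frame (taylor fb x.2) (taylor f x.1) m A, ← Finset.sum_neg_distrib, Finset.sum_apply]
  refine Finset.sum_congr rfl fun m _ => ?_
  have h6 : ∑ B, w B * u f fb m x B = (tau f fb m x)⁻¹ *
      ∑ B, w B * frame (taylor f x.1) (taylor fb x.2) m B := by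
    rw [Finset.mul_sum]
    exact Finset.sum_congr rfl fun B _ => by rw [u_apply hf hfb h.1 h.2.1 (by omega)]; ring
  rw [Pi.neg_apply, Pi.smul_apply, smul_eq_mul, ← neg_mul, ← hpair, h6,
    ub_apply hf hfb h.1 h.2.1 (by omega), tauAt_bar, tauAt_bar, mul_inv]
  ring

end Param

/-! ### Schur polynomials in the currents -/

section SchurKet

variable {K : Type*} [Field K]

theorem sum_antidiagonal_assoc {M : Type*} [AddCommMonoid M] (F : ℕ → ℕ → ℕ → M) (s : ℕ) :
    ∑ pc ∈ antidiagonal s, ∑ ab ∈ antidiagonal pc.2, F pc.1 ab.1 ab.2 =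
      ∑ qb ∈ antidiagonal s, ∑ pa ∈ antidiagonal qb.1, F pa.1 pa.2 qb.2 := by
  simp only [Finset.sum_sigma']
  refine Finset.sum_nbij' (fun i => ⟨(i.1.1 + i.2.1, i.2.2), (i.1.1, i.2.1)⟩)
    (fun i => ⟨(i.2.1, i.2.2 + i.1.2), (i.2.2, i.1.2)⟩) ?_ ?_ ?_ ?_ ?_
  · rintro ⟨⟨p, c⟩, ⟨a, b⟩⟩ h
    simp only [Finset.mem_sigma, mem_antidiagonal] at h ⊢
    exact ⟨by omega, trivial⟩
  · rintro ⟨⟨p, c⟩, ⟨a, b⟩⟩ h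
    simp only [Finset.mem_sigma, mem_antidiagonal] at h ⊢
    exact ⟨by omega, trivial⟩
  · rintro ⟨⟨p, c⟩, ⟨a, b⟩⟩ h
    simp only [Finset.mem_sigma, mem_antidiagonal] at h ⊢
    obtain ⟨-, rfl⟩ := h
    rfl
  · rintro ⟨⟨p, c⟩, ⟨a, b⟩⟩ h
    simp only [Finset.mem_sigma, mem_antidiagonal] at h ⊢
    obtain ⟨-, rfl⟩ := h
    rfl
  · intros
    rfl

theorem sum_antidiagonal_left_comm {M : Type*} [AddCommMonoid M] (F : ℕ → ℕ → ℕ → M) (s : ℕ) :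
    ∑ pc ∈ antidiagonal s, ∑ ab ∈ antidiagonal pc.2, F pc.1 ab.1 ab.2 =
      ∑ ac ∈ antidiagonal s, ∑ pb ∈ antidiagonal ac.2, F pb.1 ac.1 pb.2 := by
  rw [sum_antidiagonal_assoc, sum_antidiagonal_assoc fun a p b => F p a b]
  refine Finset.sum_congr rfl fun qb _ => ?_
  rw [← Finset.Nat.sum_antidiagonal_swap]
  rfl

/-- The coefficient of `z^s` in `ψ⁺_{i₁}(z) ψ⁺_{i₂}(z) ⋯ |∅⟩`, where
`ψ⁺_i(z) = ∑_a g_a z^a ψ⁺_{i+a}` and `i₁, i₂, …` are the entries of the list. -/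
def schurKet (g : ℕ → K) : List ℕ → ℕ → KetSpace K
  | [], s => if s = 0 then 1 else 0
  | i :: L, s => ∑ ab ∈ antidiagonal s, g ab.1 • create (i + ab.1) (schurKet g L ab.2)

/-- If `g(z) = exp (ε ∑_k z^k / k)`, in the form of the logarithmic derivative, then
`schurKet g` satisfies the recursion of `exp (ε ∑_k z^k J_k / k)`. -/
theorem schurKet_succ {g : ℕ → K} {ε : K}
    (hg : ∀ s : ℕ, ((s : K) + 1) * g (s + 1) = ε * ∑ kb ∈ antidiagonal s, g kb.2)
    (L : List ℕ) (s : ℕ) :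
    ((s : K) + 1) • schurKet g L (s + 1) =
      ε • ∑ kb ∈ antidiagonal s, current (kb.1 + 1) (schurKet g L kb.2) := by
  induction L generalizing s with
  | nil =>
    simp only [schurKet, Nat.succ_ne_zero, if_false, smul_zero]
    rw [Finset.sum_eq_zero, smul_zero]
    intro kb _
    split_ifs
    · exact current_one _
    · exact current_zero _
  | cons i L ih =>
    -- the left-hand side, splitting the degree `s + 1 = a + b`
    have h1 : ((s : K) + 1) • schurKet g (i :: L) (s + 1) =
        ∑ ab ∈ antidiagonal (s + 1),
          (((ab.1 : K) * g ab.1) • create (i + ab.1) (schurKet g L ab.2) +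
            g ab.1 • create (i + ab.1) ((ab.2 : K) • schurKet g L ab.2)) := by
      rw [schurKet, Finset.smul_sum]
      refine Finset.sum_congr rfl fun ab hab => ?_
      have : (ab.1 : K) + ab.2 = s + 1 := by
        exact_mod_cast congrArg (Nat.cast (R := K)) (mem_antidiagonal.1 hab)
      rw [create_smul, smul_smul, smul_smul, ← add_smul, ← this]
      congr 1
      ring
    have h2 : ∀ kb ∈ antidiagonal s, current (kb.1 + 1) (schurKet g (i :: L) kb.2) =
        ∑ ab ∈ antidiagonal kb.2,
          (g ab.1 • create (i + (kb.1 + ab.1) + 1) (schurKet g L ab.2) +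
            g ab.1 • create (i + ab.1) (current (kb.1 + 1) (schurKet g L ab.2))) := by
      intro kb _
      rw [schurKet, current_sum]
      refine Finset.sum_congr rfl fun ab _ => ?_
      rw [current_smul, current_create, smul_add,
        show i + ab.1 + (kb.1 + 1) = i + (kb.1 + ab.1) + 1 by omega]
    rw [h1, Finset.sum_congr rfl h2, Finset.sum_add_distrib]
    simp only [Finset.sum_add_distrib, smul_add]
    congr 1
    · rw [Finset.Nat.sum_antidiagonal_succ, sum_antidiagonal_assoc fun k a b =>
        g a • create (i + (k + a) + 1) (schurKet g L b), Nat.cast_zero, zero_mul, zero_smul,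
        zero_add, Finset.smul_sum]
      refine Finset.sum_congr rfl fun qb _ => ?_
      rw [Nat.cast_add_one, hg, Finset.mul_sum, Finset.sum_smul, Finset.smul_sum]
      refine Finset.sum_congr rfl fun pa hpa => ?_
      rw [mem_antidiagonal.1 hpa, smul_smul, add_assoc]
    · rw [Finset.Nat.sum_antidiagonal_succ', sum_antidiagonal_left_comm fun k a b =>
        g a • create (i + a) (current (k + 1) (schurKet g L b)), Nat.cast_zero, zero_smul,
        create_zero, smul_zero, zero_add, Finset.smul_sum]
      refine Finset.sum_congr rfl fun ac _ => ?_
      rw [Nat.cast_add_one, ih, create_smul, create_sum, smul_comm, Finset.smul_sum]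

theorem schurKet_zero {g : ℕ → K} (hg : g 0 = 1) (L : List ℕ) :
    schurKet g L 0 = L.foldr create 1 := by
  induction L with
  | nil => rfl
  | cons i L ih => simp [schurKet, ih, hg]

/-- The modes of `|m⟩`. -/
def modes : ℕ → List ℕ
  | 0 => []
  | m + 1 => m :: modes m

theorem foldr_modes (m : ℕ) : (modes m).foldr create 1 = ket K m := by
  induction m with
  | zero => rfl
  | succ m ih => rw [modes, List.foldr_cons, ih, ket]

/-- Raising a state by `exp (∑_k z^k J_k / k)` only moves its topmost particle: all other
contributions cancel in pairs. -/
theorem schurKet_one_modes [CharZero K] (m s : ℕ) :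
    schurKet (fun _ => (1 : K)) (modes (m + 1)) s = create (m + s) (ket K m) := by
  induction m generalizing s with
  | zero =>
    rw [modes, modes, schurKet, Finset.sum_eq_single_of_mem (s, 0) (by simp)]
    · simp [schurKet, ket]
    · intro ab hab hne
      have : ab.2 ≠ 0 := fun h => hne (by
        rw [mem_antidiagonal] at hab; ext <;> simp only <;> omega)
      simp [schurKet, this, create_zero]
  | succ m ih =>
    rw [modes, schurKet]
    simp only [ih, one_smul]
    cases s with
    | zero => simp [ket]
    | succ s =>
      rw [Finset.Nat.sum_antidiagonal_succ']
      have h0 : ∑ p ∈ antidiagonal s,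
          create (m + 1 + p.1) (create (m + (p.2 + 1)) (ket K m)) = 0 := by
        have h : ∑ p ∈ antidiagonal s,
            create (m + 1 + p.1) (create (m + (p.2 + 1)) (ket K m)) =
            -∑ p ∈ antidiagonal s,
              create (m + 1 + p.1) (create (m + (p.2 + 1)) (ket K m)) := by
          conv_lhs => rw [← Finset.Nat.sum_antidiagonal_swap]
          rw [← Finset.sum_neg_distrib]
          refine Finset.sum_congr rfl fun p _ => ?_
          rw [create_create, Prod.fst_swap, Prod.snd_swap,
            show m + (p.1 + 1) = m + 1 + p.1 by omega,
            show m + 1 + p.2 = m + (p.2 + 1) by omega]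
        -- the sum is its own negative, under exchange of the two particles
        have h2 : (2 : K) • ∑ p ∈ antidiagonal s,
            create (m + 1 + p.1) (create (m + (p.2 + 1)) (ket K m)) = 0 := by
          rw [two_smul]
          nth_rewrite 1 [h]
          exact neg_add_cancel _
        exact (smul_eq_zero.1 h2).resolve_left two_ne_zero
      rw [h0, add_zero, add_zero, ket]

/-- The coefficients of `1 - z = exp (-∑_k z^k / k)`. -/
def lowerCoeff (K : Type*) [Field K] (a : ℕ) : K := if a = 0 then 1 else if a = 1 then -1 else 0

/-- Lowering by `exp (-∑_k z^k J_k / k)` moves each particle by at most one step, which opens a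
single hole. -/
theorem schurKet_neg_modes (l s : ℕ) :
    schurKet (lowerCoeff K) (modes l) s =
      if s ≤ l then annih (l - s) (ket K (l + 1)) else 0 := by
  unfold lowerCoeff
  induction l generalizing s with
  | zero =>
    rcases Nat.eq_zero_or_pos s with rfl | hs
    · rw [if_pos le_rfl, annih_ket_self]; rfl
    · rw [if_neg (by omega), modes, schurKet, if_neg (by omega)]
  | succ l ih =>
    rw [modes, schurKet]
    simp only [ih]
    cases s with
    | zero =>
      rw [if_pos (Nat.zero_le _), Nat.sub_zero, annih_ket_self]
      rw [antidiagonal_zero, Finset.sum_singleton, if_pos (Nat.zero_le _), Nat.sub_zero,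
        annih_ket_self, if_pos rfl, one_smul, ket, add_zero]
    | succ s =>
      rw [Finset.Nat.sum_antidiagonal_succ]
      have h0 : ∑ p ∈ antidiagonal s,
          (if p.1 + 1 = 0 then (1 : K) else if p.1 + 1 = 1 then -1 else 0) •
            create (l + (p.1 + 1)) (if p.2 ≤ l then annih (l - p.2) (ket K (l + 1)) else 0) =
          -create (l + 1) (if s ≤ l then annih (l - s) (ket K (l + 1)) else 0) := by
        rw [Finset.sum_eq_single_of_mem (0, s) (by simp)]
        · simp
        · intro p hp hne
          have : p.1 ≠ 0 := fun h => hne (by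
            rw [mem_antidiagonal] at hp; ext <;> simp only <;> omega)
          simp [this]
      rw [h0, if_pos rfl, one_smul, add_zero]
      have h1 : create l (if s + 1 ≤ l then annih (l - (s + 1)) (ket K (l + 1)) else 0) = 0 := by
        split_ifs with h
        · rw [ket, annih_create, if_neg (by omega), zero_sub, create_neg, create_create_self,
            neg_zero]
        · exact create_zero _
      rw [h1, zero_add]
      by_cases h : s ≤ l
      · rw [if_pos h, if_pos (by omega), ket.eq_2 K (l + 1), annih_create, if_neg (by omega),
          zero_sub, show l + 1 - (s + 1) = l - s by omega]
      · rw [if_neg h, if_neg (by omega), create_zero, neg_zero]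

end SchurKet

/-! ### The recursion of the Schur polynomials -/

section SchurSum

/-- The exponents `i` with `∑_j (j + 1) i_j = t`, where `i_j` belongs to the variable of weight
`j + 1`. -/
def weightSet (M t : ℕ) : Finset (Fin M → ℕ) :=
  (Fintype.piFinset fun _ : Fin M => Finset.range (t + 1)).filter
    fun i => ∑ j : Fin M, ((j : ℕ) + 1) * i j = t

theorem mem_weightSet {M t : ℕ} {i : Fin M → ℕ} :
    i ∈ weightSet M t ↔ ∑ j : Fin M, ((j : ℕ) + 1) * i j = t := by
  rw [weightSet, Finset.mem_filter, and_iff_right_iff_imp]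
  intro h
  rw [Fintype.mem_piFinset]
  intro j
  have h1 : ((j : ℕ) + 1) * i j ≤ t := by
    rw [← h]
    exact Finset.single_le_sum (f := fun j : Fin M => ((j : ℕ) + 1) * i j)
      (fun _ _ => Nat.zero_le _) (Finset.mem_univ j)
  have h2 : i j ≤ ((j : ℕ) + 1) * i j := Nat.le_mul_of_pos_left _ (Nat.succ_pos _)
  rw [Finset.mem_range]
  omega

variable {K : Type*} [Field K] {A : Type*} [CommRing A] [Algebra K A]

/-- The monomial `∏_j (ε x_j / (j + 1))^{i_j} / i_j!`. -/
def schurTerm (ε : K) (x : ℕ → A) {M : ℕ} (i : Fin M → ℕ) : A :=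
  ∏ j : Fin M, (((Nat.factorial (i j) : K))⁻¹ * (ε / (((j : ℕ) + 1 : ℕ) : K)) ^ (i j)) •
    x j ^ i j

theorem schurTerm_add_single [CharZero K] (ε : K) (x : ℕ → A) {M : ℕ} (i : Fin M → ℕ) (j : Fin M) :
    ((((j : ℕ) + 1) * (i j + 1) : ℕ) : K) • schurTerm ε x (i + Pi.single j 1) =
      ε • (x j * schurTerm ε x i) := by
  rw [schurTerm, schurTerm, ← Finset.mul_prod_erase _ _ (Finset.mem_univ j),
    ← Finset.mul_prod_erase (Finset.univ : Finset (Fin M)) (fun j =>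
      (((Nat.factorial (i j) : K))⁻¹ * (ε / (((j : ℕ) + 1 : ℕ) : K)) ^ (i j)) • x j ^ i j)
      (Finset.mem_univ j)]
  have h : ∀ k ∈ Finset.univ.erase j, (i + Pi.single j 1 : Fin M → ℕ) k = i k := by
    intro k hk
    rw [Pi.add_apply, Pi.single_eq_of_ne (Finset.ne_of_mem_erase hk), add_zero]
  rw [Finset.prod_congr rfl fun k hk => by rw [h k hk], Pi.add_apply, Pi.single_eq_same,
    ← mul_assoc, ← smul_mul_assoc, ← smul_mul_assoc]
  congr 1
  rw [mul_smul_comm, smul_smul, smul_smul, ← pow_succ']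
  congr 1
  have h1 : (((j : ℕ) + 1 : ℕ) : K) ≠ 0 := Nat.cast_ne_zero.2 (Nat.succ_ne_zero _)
  have h2 : ((i j + 1 : ℕ) : K) ≠ 0 := Nat.cast_ne_zero.2 (Nat.succ_ne_zero _)
  have h3 : ((Nat.factorial (i j) : ℕ) : K) ≠ 0 := Nat.cast_ne_zero.2 (Nat.factorial_ne_zero _)
  rw [Nat.factorial_succ, Nat.cast_mul, Nat.cast_mul, pow_succ]
  field_simp

theorem schurSum_zero (ε : K) (x : ℕ → A) (M : ℕ) :
    ∑ i ∈ weightSet M 0, schurTerm ε x i = 1 := by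
  have : weightSet M 0 = {0} := by
    ext i
    rw [mem_weightSet, Finset.mem_singleton, Finset.sum_eq_zero_iff]
    simp [funext_iff]
  rw [this, Finset.sum_singleton]
  simp [schurTerm]

/-- The recursion `(t + 1) χ_{t+1} = ε ∑_{k + b = t} x_k χ_b`, by counting the weight of each
monomial in two ways. -/
theorem schurSum_succ [CharZero K] (ε : K) (x : ℕ → A) {M t : ℕ} (ht : t < M) :
    ((t : K) + 1) • ∑ i ∈ weightSet M (t + 1), schurTerm ε x i =
      ε • ∑ kb ∈ antidiagonal t, x kb.1 * ∑ i ∈ weightSet M kb.2, schurTerm ε x i := by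
  have h1 : ((t : K) + 1) • ∑ i ∈ weightSet M (t + 1), schurTerm ε x i =
      ∑ j : Fin M, ∑ i ∈ weightSet M (t + 1),
        ((((j : ℕ) + 1) * i j : ℕ) : K) • schurTerm ε x i := by
    rw [Finset.sum_comm, Finset.smul_sum]
    refine Finset.sum_congr rfl fun i hi => ?_
    rw [← Finset.sum_smul, ← Nat.cast_sum, mem_weightSet.1 hi, Nat.cast_add_one]
  have h2 : ∀ j : Fin M, ∑ i ∈ weightSet M (t + 1),
        ((((j : ℕ) + 1) * i j : ℕ) : K) • schurTerm ε x i =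
      if (j : ℕ) ≤ t then ε • (x j * ∑ i ∈ weightSet M (t - j), schurTerm ε x i) else 0 := by
    intro j
    have hadd : ∀ i : Fin M → ℕ, ∑ k : Fin M, ((k : ℕ) + 1) * (i + Pi.single j 1 : Fin M → ℕ) k =
        ∑ k : Fin M, ((k : ℕ) + 1) * i k + (j + 1) := by
      intro i
      simp only [Pi.add_apply, mul_add, Finset.sum_add_distrib]
      congr 1
      rw [Finset.sum_eq_single j (fun k _ hk => by rw [Pi.single_eq_of_ne hk, mul_zero])
        fun h => absurd (Finset.mem_univ j) h, Pi.single_eq_same, mul_one]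
    have hsub : ∀ i : Fin M → ℕ, i j ≠ 0 → i - Pi.single j 1 + Pi.single j 1 = i := by
      intro i hi
      ext k
      by_cases hk : k = j
      · subst hk
        simp only [Pi.add_apply, Pi.sub_apply, Pi.single_eq_same]
        omega
      · simp [Pi.single_eq_of_ne hk]
    rw [← Finset.sum_filter_of_ne (p := fun i : Fin M → ℕ => i j ≠ 0) fun i _ h h0 => h (by
      rw [h0, mul_zero, Nat.cast_zero, zero_smul])]
    split_ifs with hj
    · rw [Finset.mul_sum, Finset.smul_sum]
      refine Finset.sum_nbij' (fun i => i - Pi.single j 1) (fun i => i + Pi.single j 1) ?_ ?_ ?_ ?_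
        ?_
      · intro i hi
        rw [Finset.mem_filter, mem_weightSet] at hi
        have := hadd (i - Pi.single j 1)
        rw [hsub i hi.2, hi.1] at this
        rw [mem_weightSet]
        omega
      · intro i hi
        rw [mem_weightSet] at hi
        rw [Finset.mem_filter, mem_weightSet, hadd, hi]
        exact ⟨by omega, by simp⟩
      · intro i hi
        exact hsub i (Finset.mem_filter.1 hi).2
      · intro i _
        ext k
        simp
      · intro i hi
        have h := schurTerm_add_single ε x (i - Pi.single j 1) j
        have hi := (Finset.mem_filter.1 hi).2
        rw [hsub i hi] at h
        rw [← h, Pi.sub_apply, Pi.single_eq_same, show i j - 1 + 1 = i j by omega]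
    · refine Finset.sum_eq_zero fun i hi => ?_
      rw [Finset.mem_filter, mem_weightSet] at hi
      have := hadd (i - Pi.single j 1)
      rw [hsub i hi.2, hi.1] at this
      omega
  rw [h1, Finset.sum_congr rfl fun j _ => h2 j, Fin.sum_univ_eq_sum_range (fun j =>
    if j ≤ t then ε • (x j * ∑ i ∈ weightSet M (t - j), schurTerm ε x i) else 0) M,
    Finset.Nat.sum_antidiagonal_eq_sum_range_succ_mk, Finset.smul_sum,
    ← Finset.sum_subset (Finset.range_mono (show t.succ ≤ M from ht))]
  · exact Finset.sum_congr rfl fun j hj => if_pos (Nat.lt_succ_iff.1 (Finset.mem_range.1 hj))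
  · intro j _ hj
    exact if_neg fun h => hj (Finset.mem_range.2 (Nat.lt_succ_iff.2 h))

end SchurSum

section SchurCurrent

variable {K : Type*} [Field K] [CharZero K]

open scoped IsMulCommutative in
/-- `χ_s(ε J) (ψ⁺_{i₁} ψ⁺_{i₂} ⋯ |∅⟩)` as a coefficient of `ψ⁺_{i₁}(z) ψ⁺_{i₂}(z) ⋯ |∅⟩`: both sides
satisfy the same recursion, in the commutative algebra generated by the currents. -/
theorem sum_current_eq_schurKet {g : ℕ → K} {ε : K} (hg0 : g 0 = 1)
    (hg : ∀ s : ℕ, ((s : K) + 1) * g (s + 1) = ε * ∑ kb ∈ antidiagonal s, g kb.2)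
    (L : List ℕ) (s : ℕ) :
    ∑ i ∈ weightSet s s,
      (∏ j : Fin s, ((Nat.factorial (i j) : K))⁻¹ * (ε / (((j : ℕ) + 1 : ℕ) : K)) ^ (i j)) •
        (List.finRange s).foldr (fun (j : Fin s) h => (current ((j : ℕ) + 1))^[i j] h)
          (L.foldr create (1 : KetSpace K)) = schurKet g L s := by
  let S : Set (Module.End K (KetSpace K)) := Set.range fun p : ℕ => currentLin p
  have hS : ∀ a ∈ S, ∀ b ∈ S, a * b = b * a := by
    rintro _ ⟨p, rfl⟩ _ ⟨q, rfl⟩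
    exact LinearMap.ext fun k => current_comm p q k
  have := Algebra.isMulCommutative_adjoin K hS
  let x : ℕ → Algebra.adjoin K S := fun p =>
    ⟨currentLin (p + 1), Algebra.subset_adjoin ⟨p + 1, rfl⟩⟩
  -- the operators `χ_t`, all with the same number of variables
  have hrec : ∀ t ≤ s, ((∑ i ∈ weightSet s t, schurTerm ε x i : Algebra.adjoin K S) :
      Module.End K (KetSpace K)) (L.foldr create 1) = schurKet g L t := by
    intro t
    induction t using Nat.strong_induction_on with
    | _ t ih =>
      intro ht
      cases t with
      | zero =>
        rw [schurSum_zero, schurKet_zero hg0]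
        rfl
      | succ t =>
        have h1 := congrArg (fun a : Algebra.adjoin K S =>
          (a : Module.End K (KetSpace K)) (L.foldr create 1)) (schurSum_succ ε x ht)
        have h2 := schurKet_succ hg L t
        have hne : (t : K) + 1 ≠ 0 := Nat.cast_add_one_ne_zero t
        refine smul_right_injective _ hne ?_
        beta_reduce
        rw [h2]
        refine Eq.trans h1 ?_
        rw [Subalgebra.coe_smul, LinearMap.smul_apply]
        congr 1
        rw [AddSubmonoidClass.coe_finsetSum, LinearMap.sum_apply]
        refine Finset.sum_congr rfl fun kb hkb => ?_
        have hkb := mem_antidiagonal.1 hkb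
        rw [← ih kb.2 (by omega) (by omega)]
        rfl
  rw [← hrec s le_rfl, AddSubmonoidClass.coe_finsetSum, LinearMap.sum_apply]
  refine Finset.sum_congr rfl fun i _ => ?_
  rw [schurTerm, Finset.prod_smul, Subalgebra.coe_smul, LinearMap.smul_apply]
  congr 1
  rw [Fin.prod_univ_def]
  have : ∀ L' : List (Fin s), L'.foldr (fun (j : Fin s) h => (current ((j : ℕ) + 1))^[i j] h)
      (L.foldr create 1) = (((L'.map fun j : Fin s => x j ^ i j).prod : Algebra.adjoin K S) :
        Module.End K (KetSpace K)) (L.foldr create 1) := by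
    intro L'
    induction L' with
    | nil => rfl
    | cons j L' ih =>
      rw [List.foldr_cons, ih, List.map_cons, List.prod_cons, Subalgebra.coe_mul,
        Subalgebra.coe_pow, Module.End.mul_apply, Module.End.pow_apply]
      rfl
  exact this _

end SchurCurrent

/-! ### Schur polynomial derivatives of the tau-functions -/

section SchurTau

/-- If `D_α` acts on the functions `y ↦ Φ_y(k)` over `Ω` as `J_α` acts on `k`, then the Schur
polynomials in the `D_α` act as those in the currents. In `hD` the function `h` agrees with
`y ↦ Φ_y(k)` only on `Ω`, as iterated derivatives do. -/
theorem schurOp_eq {K X : Type*} [Field K] [CharZero K] (Dop : ℕ → (X → K) → (X → K)) (Ω : Set X)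
    (Φ : X → KetSpace K →ₗ[K] K) (B : ℕ)
    (hD : ∀ α ≤ B, ∀ (h : X → K) (k : KetSpace K), (∀ y ∈ Ω, h y = Φ y k) →
      ∀ y ∈ Ω, Dop α h y = Φ y (current α k))
    {g : ℕ → K} {ε : K} (hg0 : g 0 = 1)
    (hg : ∀ s : ℕ, ((s : K) + 1) * g (s + 1) = ε * ∑ kb ∈ antidiagonal s, g kb.2)
    (L : List ℕ) {s : ℕ} (hs : s ≤ B) {x : X} (hx : x ∈ Ω) :
    schurOp Dop ε s (fun y => Φ y (L.foldr create 1)) x = Φ x (schurKet g L s) := by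
  rw [← sum_current_eq_schurKet hg0 hg, map_sum]
  refine Finset.sum_congr rfl fun i _ => ?_
  rw [map_smul, smul_eq_mul]
  congr 1
  have hiter : ∀ α ≤ B, ∀ (r : ℕ) (h : X → K) (k : KetSpace K), (∀ y ∈ Ω, h y = Φ y k) →
      ∀ y ∈ Ω, (Dop α)^[r] h y = Φ y ((current α)^[r] k) := by
    intro α hα r h k hk
    induction r with
    | zero => exact hk
    | succ r ih =>
      rw [Function.iterate_succ_apply', Function.iterate_succ_apply']
      exact hD α hα _ _ ih
  have hfold : ∀ L' : List (Fin s), ∀ y ∈ Ω,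
      (L'.foldr (fun (j : Fin s) h => (Dop ((j : ℕ) + 1))^[i j] h)
        fun y => Φ y (L.foldr create 1)) y =
      Φ y (L'.foldr (fun (j : Fin s) h => (current ((j : ℕ) + 1))^[i j] h) (L.foldr create 1)) := by
    intro L'
    induction L' with
    | nil => exact fun _ _ => rfl
    | cons j L' ih => exact hiter _ (by omega) _ _ _ ih
  exact hfold _ x hx

/-- The logarithmic derivative of `1 / (1 - z)`, coefficientwise. -/
theorem logDeriv_one {K : Type*} [Field K] (s : ℕ) :
    ((s : K) + 1) * (fun _ : ℕ => (1 : K)) (s + 1) =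
      1 * ∑ kb ∈ antidiagonal s, (fun _ : ℕ => (1 : K)) kb.2 := by
  simp

/-- The logarithmic derivative of `1 - z`, coefficientwise. -/
theorem logDeriv_neg {K : Type*} [Field K] (s : ℕ) :
    ((s : K) + 1) * lowerCoeff K (s + 1) = (-1) * ∑ kb ∈ antidiagonal s, lowerCoeff K kb.2 := by
  unfold lowerCoeff
  cases s with
  | zero => simp
  | succ s =>
    rw [Finset.Nat.sum_antidiagonal_succ', Finset.sum_eq_single_of_mem (s, 0) (by simp)]
    · simp
    · intro p hp hne
      have : p.2 ≠ 0 := fun h => hne (by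
        rw [mem_antidiagonal] at hp; ext <;> simp only <;> omega)
      simp [this]

variable {K : Type*} [Field K] {n : ℕ} (c cb : Fin (n + 1) → ℕ → K)

/-- The terms of `∑_t ⟨m+1| 𝒢 ψ⁺_{t+p} |m⟩ ⟨ℓ| 𝒢 ψ_t |ℓ+1⟩`, reindexed by `t + p = m + s`; those
with `t + p < m` vanish by the Pauli principle. -/
theorem shiftPair_eq_sum_schur (p l m : ℕ) :
    shiftPair c cb p l m = ∑ s ∈ Finset.range (l + p + 1 - m),
      embeddingForm c cb (bra K (m + 1)) (create (m + s) (ket K m)) *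
        embeddingForm c cb (bra K l)
          (if l + p - m - s ≤ l then annih (l - (l + p - m - s)) (ket K (l + 1)) else 0) := by
  have h1 : shiftPair c cb p l m = ∑ t ∈ (Finset.range (l + 1)).filter (fun t => m ≤ t + p),
      coef c cb l t * polyPair cb c m (t + p) := by
    refine (Finset.sum_filter_of_ne fun t _ ht => ?_).symm
    by_contra h
    exact ht (by rw [polyPair_of_lt _ _ (not_le.1 h), mul_zero])
  have h2 : ∀ s ∈ Finset.range (l + p + 1 - m),
      embeddingForm c cb (bra K (m + 1)) (create (m + s) (ket K m)) *
        embeddingForm c cb (bra K l)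
          (if l + p - m - s ≤ l then annih (l - (l + p - m - s)) (ket K (l + 1)) else 0) =
      if l + p - m - s ≤ l then coef c cb l (l - (l + p - m - s)) * polyPair cb c m (m + s)
        else 0 := by
    intro s _
    split_ifs
    · rw [polyPair_swap, mul_comm]; rfl
    · rw [embeddingForm_zero, mul_zero]
  rw [h1, Finset.sum_congr rfl h2, ← Finset.sum_filter]
  refine Finset.sum_nbij' (fun t => t + p - m) (fun s => m + s - p) ?_ ?_ ?_ ?_ ?_
  all_goals
    intro t ht
    simp only [Finset.mem_filter, Finset.mem_range] at ht ⊢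
  · omega
  · omega
  · omega
  · omega
  · rw [show l - (l + p - m - (t + p - m)) = t by omega, show m + (t + p - m) = t + p by omega]

end SchurTau

section Param

variable {𝕜 : Type*} [RCLike 𝕜] {K : Type*} [RCLike K] [NormedAlgebra 𝕜 K] {n N : ℕ}
variable {f₀ fb₀ : 𝕜 → Fin (n + 1) → K} {U Ub : Set (Times 𝕜 N)}
  {f fb : Times 𝕜 N → Fin (n + 1) → K} {x : Times 𝕜 N × Times 𝕜 N}

theorem schurOp_tau (hf : IsWParam f₀ U f) (hfb : IsWParam fb₀ Ub fb) (hx : x.1 ∈ U)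
    (hxb : x.2 ∈ Ub) {g : ℕ → K} {ε : K} (hg0 : g 0 = 1)
    (hg : ∀ s : ℕ, ((s : K) + 1) * g (s + 1) = ε * ∑ kb ∈ antidiagonal s, g kb.2)
    (l : ℕ) {s : ℕ} (hs : s ≤ N) :
    schurOp (fun α => D (dirZ 𝕜 N α)) ε s (tau f fb l) x =
      embeddingForm (taylor f x.1) (taylor fb x.2) (bra K l) (schurKet g (modes l) s) := by
  have h := schurOp_eq (fun α => D (V := K) (dirZ 𝕜 N α)) {y | y.1 ∈ U ∧ y.2 ∈ Ub}
    (fun y => embeddingLin (taylor f y.1) (taylor fb y.2) (bra K l)) N ?_ hg0 hg (modes l) hs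
    (x := x) ⟨hx, hxb⟩
  · rw [foldr_modes] at h
    exact h
  · intro α hα h k hk y hy
    have he : h =ᶠ[𝓝 y] fun y => G f fb y (bra K l) k := by
      filter_upwards [eventually_mem_prod hf hfb hy.1 hy.2] with z hz using hk z hz
    exact ((hasLineDerivAt_G hf hy.1 hα (bra K l) k).congr_of_eventuallyEq he).lineDeriv

theorem schurOp_tau_bar (hf : IsWParam f₀ U f) (hfb : IsWParam fb₀ Ub fb) (hx : x.1 ∈ U)
    (hxb : x.2 ∈ Ub) {g : ℕ → K} {ε : K} (hg0 : g 0 = 1)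
    (hg : ∀ s : ℕ, ((s : K) + 1) * g (s + 1) = ε * ∑ kb ∈ antidiagonal s, g kb.2)
    (l : ℕ) {s : ℕ} (hs : s ≤ N) :
    schurOp (fun α => D (dirZbar 𝕜 N α)) ε s (tau f fb l) x =
      embeddingForm (taylor fb x.2) (taylor f x.1) (bra K l) (schurKet g (modes l) s) := by
  have h := schurOp_eq (fun α => D (V := K) (dirZbar 𝕜 N α)) {y | y.1 ∈ U ∧ y.2 ∈ Ub}
    (fun y => embeddingLin (taylor fb y.2) (taylor f y.1) (bra K l)) N ?_ hg0 hg (modes l) hs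
    (x := x) ⟨hx, hxb⟩
  · rw [foldr_modes] at h
    rw [← show (fun y => embeddingLin (taylor fb y.2) (taylor f y.1) (bra K l) (ket K l)) =
      tau f fb l from funext fun y => tauAt_bar (f := f) (fb := fb) l y]
    exact h
  · intro α hα h k hk y hy
    have he : h =ᶠ[𝓝 y] fun y => G fb f y.swap (bra K l) k := by
      filter_upwards [eventually_mem_prod hf hfb hy.1 hy.2] with z hz using hk z hz
    exact ((hasLineDerivAt_swap (x := y) (v := dirZbar 𝕜 N α) (g := fun y => G fb f y (bra K l) k)
      (hasLineDerivAt_G (x := y.swap) hfb hy.2 hα (bra K l) k)).congr_of_eventuallyEq he).lineDeriv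

theorem Fmat_eq_schur (hf : IsWParam f₀ U f) (hfb : IsWParam fb₀ Ub fb) (hx : x.1 ∈ U)
    (hxb : x.2 ∈ Ub) {p l m : ℕ} (h : l + p ≤ m + N) :
    Fmat f fb p x l m = (tau f fb m x * tau f fb (m + 1) x)⁻¹ *
      ∑ s ∈ Finset.range (l + p + 1 - m),
        schurOp (fun α => D (dirZ 𝕜 N α)) 1 s (tau f fb (m + 1)) x *
        schurOp (fun α => D (dirZ 𝕜 N α)) (-1) (l + p - m - s) (tau f fb l) x := by
  rw [Fmat_eq, shiftCoef, shiftPair_eq_sum_schur]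
  congr 1
  refine Finset.sum_congr rfl fun s hs => ?_
  rw [Finset.mem_range] at hs
  rw [schurOp_tau (g := fun _ => (1 : K)) hf hfb hx hxb rfl logDeriv_one _ (by omega),
    schurKet_one_modes,
    schurOp_tau hf hfb hx hxb (if_pos rfl) logDeriv_neg _ (by omega), schurKet_neg_modes]

theorem Gmat_eq_schur (hf : IsWParam f₀ U f) (hfb : IsWParam fb₀ Ub fb) (hx : x.1 ∈ U)
    (hxb : x.2 ∈ Ub) {p l m : ℕ} (h : l + p ≤ m + N) :
    Gmat f fb p x m l = (tau f fb m x * tau f fb (m + 1) x)⁻¹ *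
      ∑ s ∈ Finset.range (l + p + 1 - m),
        schurOp (fun α => D (dirZbar 𝕜 N α)) 1 s (tau f fb (m + 1)) x *
        schurOp (fun α => D (dirZbar 𝕜 N α)) (-1) (l + p - m - s) (tau f fb l) x := by
  rw [Gmat_eq, shiftCoef, shiftPair_eq_sum_schur, tauAt_bar, tauAt_bar]
  congr 1
  refine Finset.sum_congr rfl fun s hs => ?_
  rw [Finset.mem_range] at hs
  rw [schurOp_tau_bar (g := fun _ => (1 : K)) hf hfb hx hxb rfl logDeriv_one _ (by omega),
    schurKet_one_modes,
    schurOp_tau_bar hf hfb hx hxb (if_pos rfl) logDeriv_neg _ (by omega), schurKet_neg_modes]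

/-! ### Zakharov–Shabat equations -/

/-- The commutator of two first-order matrix operators is multiplication by the integrability
defect: the second derivatives cancel by symmetry, the first derivatives by the product rule. -/
theorem zsCommutator_eq (d₁ d₂ : Times 𝕜 N × Times 𝕜 N)
    {M₁ M₂ : Times 𝕜 N × Times 𝕜 N → Matrix (Fin (n + 1)) (Fin (n + 1)) K}
    (h₁ : ∀ i j, ContDiffAt 𝕜 ∞ (fun y => M₁ y i j) x)
    (h₂ : ∀ i j, ContDiffAt 𝕜 ∞ (fun y => M₂ y i j) x)
    {φ : Times 𝕜 N × Times 𝕜 N → Fin (n + 1) → K} (hφ : ContDiffAt 𝕜 ∞ φ x) :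
    zsCommutator d₁ M₁ d₂ M₂ φ x = (integrabilityDefect d₁ M₁ d₂ M₂ x).mulVec (φ x) := by
  have key : ∀ (d e : Times 𝕜 N × Times 𝕜 N)
      (M : Times 𝕜 N × Times 𝕜 N → Matrix (Fin (n + 1)) (Fin (n + 1)) K),
      (∀ i j, ContDiffAt 𝕜 ∞ (fun y => M y i j) x) →
      D d (nabla e M φ) x =
        D d (D e φ) x - ((matD d M x).mulVec (φ x) + (M x).mulVec (D d φ x)) := by
    intro d e M hM
    refine HasLineDerivAt.lineDeriv ?_
    refine hasLineDerivAt_sub (hasLineDerivAt_of_contDiffAt (contDiffAt_lineDeriv hφ e) d) ?_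
    rw [hasLineDerivAt_pi]
    intro i
    have h := hasLineDerivAt_sum (T := Finset.univ) fun j _ =>
      hasLineDerivAt_mul (hasLineDerivAt_of_contDiffAt (hM i j) d)
        (hasLineDerivAt_pi.1 (hasLineDerivAt_of_contDiffAt hφ d) j)
    rw [Finset.sum_add_distrib] at h
    exact h
  have hcomm : D d₁ (D d₂ φ) x = D d₂ (D d₁ φ) x := lineDeriv_comm hφ d₂ d₁
  rw [zsCommutator, nabla, key d₁ d₂ M₂ h₂, nabla.eq_1 d₂ M₂ (nabla d₁ M₁ φ), key d₂ d₁ M₁ h₁,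
    hcomm, integrabilityDefect, nabla, nabla]
  simp only [Matrix.mulVec_sub, Matrix.sub_mulVec, Matrix.add_mulVec, ← Matrix.mulVec_mulVec]
  abel

/-- If the moving frame solves two linear systems near `x`, their commutator annihilates the
frame, which is invertible; hence the integrability defect vanishes. -/
theorem zakharovShabat_of_frame (hf : IsWParam f₀ U f) (hfb : IsWParam fb₀ Ub fb)
    (h : x ∈ regular f fb U Ub) (hnN : n ≤ N) (d₁ d₂ : Times 𝕜 N × Times 𝕜 N)
    {M₁ M₂ : Times 𝕜 N × Times 𝕜 N → Matrix (Fin (n + 1)) (Fin (n + 1)) K}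
    (h₁ : ∀ i j, ContDiffAt 𝕜 ∞ (fun y => M₁ y i j) x)
    (h₂ : ∀ i j, ContDiffAt 𝕜 ∞ (fun y => M₂ y i j) x)
    (hu₁ : ∀ y ∈ regular f fb U Ub, ∀ l : Fin (n + 1), HasLineDerivAt 𝕜 (u f fb l)
      (∑ m : Fin (n + 1), M₁ y l m • u f fb m y) y d₁)
    (hu₂ : ∀ y ∈ regular f fb U Ub, ∀ l : Fin (n + 1), HasLineDerivAt 𝕜 (u f fb l)
      (∑ m : Fin (n + 1), M₂ y l m • u f fb m y) y d₂) :
    ZakharovShabat d₁ M₁ d₂ M₂ x := by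
  have hev := eventually_regular hf hfb h
  let w : Fin (n + 1) → Times 𝕜 N × Times 𝕜 N → Fin (n + 1) → K := fun A y l => u f fb l y A
  have hw : ∀ A, ContDiffAt 𝕜 ∞ (w A) x := fun A =>
    contDiffAt_pi.2 fun l => contDiffAt_u hf hfb h hnN (Nat.lt_succ_iff.1 l.2) A
  have hsol : ∀ (d : Times 𝕜 N × Times 𝕜 N)
      (M : Times 𝕜 N × Times 𝕜 N → Matrix (Fin (n + 1)) (Fin (n + 1)) K),
      (∀ y ∈ regular f fb U Ub, ∀ l : Fin (n + 1), HasLineDerivAt 𝕜 (u f fb l)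
        (∑ m : Fin (n + 1), M y l m • u f fb m y) y d) →
      ∀ A, nabla d M (w A) =ᶠ[𝓝 x] fun _ => 0 := by
    intro d M hM A
    filter_upwards [hev] with y hy
    rw [nabla, sub_eq_zero]
    refine HasLineDerivAt.lineDeriv (hasLineDerivAt_pi.2 fun l => ?_)
    have := hasLineDerivAt_pi.1 (hM y hy l) A
    rw [Finset.sum_apply] at this
    exact this
  have hzero : ∀ (d d' : Times 𝕜 N × Times 𝕜 N)
      (M M' : Times 𝕜 N × Times 𝕜 N → Matrix (Fin (n + 1)) (Fin (n + 1)) K) (A : Fin (n + 1)),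
      nabla d M (w A) =ᶠ[𝓝 x] (fun _ => 0) → nabla d' M' (nabla d M (w A)) x = 0 := by
    intro d d' M M' A hA
    rw [nabla, D, hA.lineDeriv_eq, hA.eq_of_nhds,
      (hasLineDerivAt_const (𝕜 := 𝕜) (0 : Fin (n + 1) → K) x d').lineDeriv, Matrix.mulVec_zero,
      sub_zero]
  have hdefect : integrabilityDefect d₁ M₁ d₂ M₂ x = 0 := by
    set Z := integrabilityDefect d₁ M₁ d₂ M₂ x with hZ
    have hA : ∀ A, Z.mulVec (w A x) = 0 := by
      intro A
      rw [hZ, ← zsCommutator_eq d₁ d₂ h₁ h₂ (hw A), zsCommutator,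
        hzero d₂ d₁ M₂ M₁ A (hsol d₂ M₂ hu₂ A), hzero d₁ d₂ M₁ M₂ A (hsol d₁ M₁ hu₁ A), sub_zero]
    ext i k
    have h3 : ∑ A, ub f fb k x A * (Z.mulVec (w A x)) i = Z i k := by
      have h4 : ∀ j : Fin (n + 1), ∑ A, Z i j * (ub f fb k x A * u f fb j x A) =
          if k = j then Z i j else 0 := by
        intro j
        rw [← Finset.mul_sum, sum_ub_mul_u hf hfb h hnN (Nat.lt_succ_iff.1 k.2)
          (Nat.lt_succ_iff.1 j.2)]
        simp [Fin.ext_iff]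
      simp only [Matrix.mulVec, dotProduct, Finset.mul_sum]
      rw [Finset.sum_comm]
      simp only [w, mul_left_comm (ub f fb k x _), h4, Finset.sum_ite_eq, Finset.mem_univ, if_true]
    rw [← h3]
    simp [hA]
  refine ⟨fun φ hφ => zsCommutator_eq d₁ d₂ h₁ h₂ hφ, hdefect, fun φ hφ => ?_⟩
  rw [zsCommutator_eq d₁ d₂ h₁ h₂ hφ, hdefect, Matrix.zero_mulVec]

theorem contDiffAt_laxZ (hf : IsWParam f₀ U f) (hfb : IsWParam fb₀ Ub fb)
    (h : x ∈ regular f fb U Ub) (p : ℕ) (i j : Fin (n + 1)) :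
    ContDiffAt 𝕜 ∞ (fun y => laxZ f fb p y i j) x := by
  simp only [laxZ_apply]
  split_ifs
  · exact ((contDiffAt_inv (contDiffAt_tau hf hfb h.1 h.2.1 _) (h.2.2 _ (by omega))).mul
      (contDiffAt_Fmat hf hfb h p i (Nat.lt_succ_iff.1 j.2))).mul
        (contDiffAt_tau hf hfb h.1 h.2.1 _)
  · exact contDiffAt_const

theorem contDiffAt_laxZbar (hf : IsWParam f₀ U f) (hfb : IsWParam fb₀ Ub fb)
    (h : x ∈ regular f fb U Ub) (p : ℕ) (i j : Fin (n + 1)) :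
    ContDiffAt 𝕜 ∞ (fun y => laxZbar f fb p y i j) x := by
  simp only [laxZbar_apply]
  split_ifs
  · exact (((contDiffAt_tau hf hfb h.1 h.2.1 _).mul
      (contDiffAt_Gmat hf hfb h p j (Nat.lt_succ_iff.1 i.2))).mul
        (contDiffAt_inv (contDiffAt_tau hf hfb h.1 h.2.1 _) (h.2.2 _ (by omega)))).neg
  · exact contDiffAt_const

/-! ### Banded form of the linear systems -/

theorem Fmat_of_lt {p l m : ℕ} (h : l + p < m) : Fmat f fb p x l m = 0 := by
  rw [Fmat_eq, shiftCoef_of_lt _ _ h]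

theorem Gmat_of_lt {p l m : ℕ} (h : l + p < m) : Gmat f fb p x m l = 0 := by
  rw [Gmat_eq, shiftCoef_of_lt _ _ h]

theorem sum_fin_eq_sum_of_support {V : Type*} [AddCommMonoid V] {T : Finset ℕ} {g : ℕ → V}
    (hT : ∀ m ∈ T, m ≤ n) (hg : ∀ m ≤ n, m ∉ T → g m = 0) :
    ∑ m : Fin (n + 1), g m = ∑ m ∈ T, g m := by
  rw [Fin.sum_univ_eq_sum_range g]
  refine (Finset.sum_subset (fun m hm => ?_) fun m hm hmT => ?_).symm
  · exact Finset.mem_range.2 (Nat.lt_succ_iff.2 (hT m hm))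
  · exact hg m (Nat.lt_succ_iff.1 (Finset.mem_range.1 hm)) hmT

theorem sum_laxZ_smul {V : Type*} [AddCommGroup V] [Module K V] (p : ℕ) (l : Fin (n + 1))
    (w : ℕ → V) :
    ∑ m : Fin (n + 1), laxZ f fb p x l m • w m =
      ∑ m ∈ Finset.Icc (l : ℕ) (min (l + p) n),
        ((tau f fb l x)⁻¹ * Fmat f fb p x l m * tau f fb m x) • w m := by
  simp only [laxZ_apply]
  rw [sum_fin_eq_sum_of_support (T := Finset.Icc (l : ℕ) (min (l + p) n)) (g := fun m =>
    (if (l : ℕ) ≤ m then (tau f fb l x)⁻¹ * Fmat f fb p x l m * tau f fb m x else 0) • w m)]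
  · exact Finset.sum_congr rfl fun m hm => by rw [if_pos (Finset.mem_Icc.1 hm).1]
  · intro m hm
    rw [Finset.mem_Icc] at hm
    omega
  · intro m hm hmT
    rw [Finset.mem_Icc] at hmT
    split_ifs with h
    · rw [Fmat_of_lt (by omega), mul_zero, zero_mul, zero_smul]
    · exact zero_smul _ _

theorem sum_laxZ_smul_col {V : Type*} [AddCommGroup V] [Module K V] (p : ℕ) (l : Fin (n + 1))
    (w : ℕ → V) :
    ∑ m : Fin (n + 1), laxZ f fb p x m l • w m =
      ∑ m ∈ Finset.Icc ((l : ℕ) - p) l,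
        ((tau f fb m x)⁻¹ * Fmat f fb p x m l * tau f fb l x) • w m := by
  simp only [laxZ_apply]
  rw [sum_fin_eq_sum_of_support (T := Finset.Icc ((l : ℕ) - p) l) (g := fun m =>
    (if m ≤ (l : ℕ) then (tau f fb m x)⁻¹ * Fmat f fb p x m l * tau f fb l x else 0) • w m)]
  · exact Finset.sum_congr rfl fun m hm => by rw [if_pos (Finset.mem_Icc.1 hm).2]
  · intro m hm
    rw [Finset.mem_Icc] at hm
    omega
  · intro m hm hmT
    rw [Finset.mem_Icc] at hmT
    split_ifs with h
    · rw [Fmat_of_lt (by omega), mul_zero, zero_mul, zero_smul]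
    · exact zero_smul _ _

theorem sum_laxZbar_smul {V : Type*} [AddCommGroup V] [Module K V] (p : ℕ) (l : Fin (n + 1))
    (w : ℕ → V) :
    ∑ m : Fin (n + 1), laxZbar f fb p x l m • w m =
      -∑ m ∈ Finset.Ico ((l : ℕ) - p) l,
        (tau f fb (l + 1) x * Gmat f fb p x l m * (tau f fb (m + 1) x)⁻¹) • w m := by
  simp only [laxZbar_apply]
  rw [sum_fin_eq_sum_of_support (T := Finset.Ico ((l : ℕ) - p) l) (g := fun m =>
    (if m < (l : ℕ) then -(tau f fb (l + 1) x * Gmat f fb p x l m * (tau f fb (m + 1) x)⁻¹)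
      else 0) • w m), ← Finset.sum_neg_distrib]
  · exact Finset.sum_congr rfl fun m hm => by rw [if_pos (Finset.mem_Ico.1 hm).2, neg_smul]
  · intro m hm
    rw [Finset.mem_Ico] at hm
    omega
  · intro m hm hmT
    rw [Finset.mem_Ico] at hmT
    split_ifs with h
    · rw [Gmat_of_lt (by omega), mul_zero, zero_mul, neg_zero, zero_smul]
    · exact zero_smul _ _

theorem sum_laxZbar_smul_col {V : Type*} [AddCommGroup V] [Module K V] (p : ℕ) (l : Fin (n + 1))
    (w : ℕ → V) :
    -∑ m : Fin (n + 1), laxZbar f fb p x m l • w m =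
      ∑ m ∈ Finset.Ioc (l : ℕ) (min (l + p) n),
        (tau f fb (m + 1) x * Gmat f fb p x m l * (tau f fb (l + 1) x)⁻¹) • w m := by
  simp only [laxZbar_apply]
  rw [sum_fin_eq_sum_of_support (T := Finset.Ioc (l : ℕ) (min (l + p) n)) (g := fun m =>
    (if (l : ℕ) < m then -(tau f fb (m + 1) x * Gmat f fb p x m l * (tau f fb (l + 1) x)⁻¹)
      else 0) • w m), ← Finset.sum_neg_distrib]
  · exact Finset.sum_congr rfl fun m hm => by
      rw [if_pos (Finset.mem_Ioc.1 hm).1, neg_smul, neg_neg]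
  · intro m hm
    rw [Finset.mem_Ioc] at hm
    omega
  · intro m hm hmT
    rw [Finset.mem_Ioc] at hmT
    split_ifs with h
    · rw [Gmat_of_lt (by omega), mul_zero, zero_mul, neg_zero, zero_smul]
    · exact zero_smul _ _

theorem Fm_eq_pow (h : x ∈ regular f fb U Ub) (p : ℕ) (l m : Fin (n + 1))
    (hlp : (l : ℕ) + p ≤ n + 1) : Fm f fb p x l m = (Fm f fb 1 x ^ p) l m := by
  simp only [Fm, Matrix.of_apply, Fmat_eq]
  exact shiftCoef_eq_pow h.2.2 p l m hlp

theorem Gm_eq_pow (h : x ∈ regular f fb U Ub) (p : ℕ) (l m : Fin (n + 1))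
    (hlp : (l : ℕ) + p ≤ n + 1) : Gm f fb p x m l = (Gm f fb 1 x ^ p) m l := by
  have ht : Gm f fb 1 x = (Matrix.of fun i j : Fin (n + 1) =>
      shiftCoef (taylor fb x.2) (taylor f x.1) 1 i j).transpose := by
    ext i j
    simp only [Gm, Matrix.of_apply, Gmat_eq, Matrix.transpose_apply]
  rw [ht, ← Matrix.transpose_pow, Matrix.transpose_apply,
    ← shiftCoef_eq_pow (fun j hj => by rw [tauAt_bar]; exact h.2.2 j hj) p l m hlp, Gm,
    Matrix.of_apply, Gmat_eq]

end Param

end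

end WGeom

theorem mainTheorem2 {𝕜 : Type*} [RCLike 𝕜] {K : Type*} [RCLike K] [NormedAlgebra 𝕜 K]
    (n N : ℕ) (hN : 1 ≤ N) (hnN : n ≤ N)
    (f₀ fb₀ : 𝕜 → Fin (n + 1) → K)
    (U Ub : Set (WGeom.Times 𝕜 N)) (f fb : WGeom.Times 𝕜 N → Fin (n + 1) → K)
    (hf : WGeom.IsWParam f₀ U f) (hfb : WGeom.IsWParam fb₀ Ub fb)
    (x : WGeom.Times 𝕜 N × WGeom.Times 𝕜 N) (hx : x.1 ∈ U) (hxb : x.2 ∈ Ub)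
    (hτ : ∀ l ≤ n + 1, WGeom.tau f fb l x ≠ 0) :
    -- the embedding operator evolves by the currents: ∂_p 𝒢 = 𝒢 J_p and ∂̄_p 𝒢 = J̄_p 𝒢
    (∀ p ≤ N, ∀ (b : WGeom.BraSpace K) (k : WGeom.KetSpace K),
      HasLineDerivAt 𝕜 (fun y => WGeom.G f fb y b k)
        (WGeom.G f fb x b (WGeom.current p k)) x (WGeom.dirZ 𝕜 N p) ∧
      HasLineDerivAt 𝕜 (fun y => WGeom.G f fb y b k)
        (WGeom.G f fb x (WGeom.braCurrent p b) k) x (WGeom.dirZbar 𝕜 N p)) ∧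
    -- (ū_ℓ, ũ_m) = δ_{ℓm}
    (∀ l ≤ n, ∀ m ≤ n,
      ∑ A, WGeom.ub f fb l x A * WGeom.u f fb m x A = if l = m then 1 else 0) ∧
    -- the four linear systems
    (∀ p ≤ N, ∀ l ≤ n,
      HasLineDerivAt 𝕜 (WGeom.u f fb l)
        (∑ m ∈ Finset.Icc l (min (l + p) n),
          ((WGeom.tau f fb l x)⁻¹ * WGeom.Fmat f fb p x l m * WGeom.tau f fb m x) •
            WGeom.u f fb m x) x (WGeom.dirZ 𝕜 N p) ∧
      HasLineDerivAt 𝕜 (WGeom.u f fb l)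
        (-∑ m ∈ Finset.Ico (l - p) l,
          (WGeom.tau f fb (l + 1) x * WGeom.Gmat f fb p x l m * (WGeom.tau f fb (m + 1) x)⁻¹) •
            WGeom.u f fb m x) x (WGeom.dirZbar 𝕜 N p) ∧
      HasLineDerivAt 𝕜 (WGeom.ub f fb l)
        (∑ m ∈ Finset.Ioc l (min (l + p) n),
          (WGeom.tau f fb (m + 1) x * WGeom.Gmat f fb p x m l * (WGeom.tau f fb (l + 1) x)⁻¹) •
            WGeom.ub f fb m x) x (WGeom.dirZbar 𝕜 N p) ∧
      HasLineDerivAt 𝕜 (WGeom.ub f fb l)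
        (-∑ m ∈ Finset.Icc (l - p) l,
          ((WGeom.tau f fb m x)⁻¹ * WGeom.Fmat f fb p x m l * WGeom.tau f fb l x) •
            WGeom.ub f fb m x) x (WGeom.dirZ 𝕜 N p)) ∧
    -- F^p and G^p are matrix elements of the p-th powers of J_1 and J̄_1 between the moving-frame
    -- states
    (∀ p : ℕ, ∀ l ≤ n, ∀ m ≤ n,
      WGeom.Fmat f fb p x l m = (WGeom.tau f fb m x * WGeom.tau f fb (m + 1) x)⁻¹ *
        WGeom.G f fb x (WGeom.braV f fb m x) ((WGeom.current 1)^[p] (WGeom.ketV f fb l x)) ∧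
      WGeom.Gmat f fb p x m l = (WGeom.tau f fb m x * WGeom.tau f fb (m + 1) x)⁻¹ *
        WGeom.G f fb x ((WGeom.braCurrent 1)^[p] (WGeom.braV f fb l x)) (WGeom.ketV f fb m x)) ∧
    -- rows of F^p, columns of G^p as those of matrix powers, as long as ℓ + p ≤ n + 1
    (∀ p : ℕ, ∀ l m : Fin (n + 1), (l : ℕ) + p ≤ n + 1 →
      WGeom.Fm f fb p x l m = (WGeom.Fm f fb 1 x ^ p) l m ∧
      WGeom.Gm f fb p x m l = (WGeom.Gm f fb 1 x ^ p) m l) ∧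
    -- expression through Schur-polynomial derivatives of the tau-functions
    (∀ p : ℕ, ∀ l ≤ n, ∀ m ≤ n, l + p ≤ m + N →
      WGeom.Fmat f fb p x l m = (WGeom.tau f fb m x * WGeom.tau f fb (m + 1) x)⁻¹ *
        ∑ s ∈ Finset.range (l + p + 1 - m),
          WGeom.schurOp (fun α => WGeom.D (WGeom.dirZ 𝕜 N α)) 1 s (WGeom.tau f fb (m + 1)) x *
          WGeom.schurOp (fun α => WGeom.D (WGeom.dirZ 𝕜 N α)) (-1) (l + p - m - s)
            (WGeom.tau f fb l) x ∧
      WGeom.Gmat f fb p x m l = (WGeom.tau f fb m x * WGeom.tau f fb (m + 1) x)⁻¹ *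
        ∑ s ∈ Finset.range (l + p + 1 - m),
          WGeom.schurOp (fun α => WGeom.D (WGeom.dirZbar 𝕜 N α)) 1 s (WGeom.tau f fb (m + 1)) x *
          WGeom.schurOp (fun α => WGeom.D (WGeom.dirZbar 𝕜 N α)) (-1) (l + p - m - s)
            (WGeom.tau f fb l) x) ∧
    -- the integrability conditions are the Zakharov–Shabat equations, and these hold
    (∀ p ≤ N, ∀ q ≤ N,
      WGeom.ZakharovShabat (WGeom.dirZ 𝕜 N p) (WGeom.laxZ f fb p)
        (WGeom.dirZbar 𝕜 N q) (WGeom.laxZbar f fb q) x ∧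
      WGeom.ZakharovShabat (WGeom.dirZ 𝕜 N p) (WGeom.laxZ f fb p)
        (WGeom.dirZ 𝕜 N q) (WGeom.laxZ f fb q) x ∧
      WGeom.ZakharovShabat (WGeom.dirZbar 𝕜 N p) (WGeom.laxZbar f fb p)
        (WGeom.dirZbar 𝕜 N q) (WGeom.laxZbar f fb q) x) := by

  have h : x ∈ WGeom.regular f fb U Ub := ⟨hx, hxb, hτ⟩
  refine ⟨fun p hp b k => ⟨WGeom.hasLineDerivAt_G hf hx hp b k,
      WGeom.hasLineDerivAt_G_bar hfb hxb hp b k⟩,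
    fun l hl m hm => WGeom.sum_ub_mul_u hf hfb h hnN hl hm,
    fun p hp l hl => ⟨?_, ?_, ?_, ?_⟩,
    fun p l _ m _ => ⟨WGeom.Fmat_eq_current p l m x, WGeom.Gmat_eq_current p l m x⟩,
    fun p l m hlp => ⟨WGeom.Fm_eq_pow h p l m hlp, WGeom.Gm_eq_pow h p l m hlp⟩,
    fun p l _ m _ hN => ⟨WGeom.Fmat_eq_schur hf hfb hx hxb hN,
      WGeom.Gmat_eq_schur hf hfb hx hxb hN⟩,
    fun p hp q hq => ⟨?_, ?_, ?_⟩⟩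
  · have := WGeom.hasLineDerivAt_u hf hfb h hnN hp ⟨l, Nat.lt_succ_iff.2 hl⟩
    rwa [WGeom.sum_laxZ_smul p _ fun m => WGeom.u f fb m x] at this
  · have := WGeom.hasLineDerivAt_u_bar hf hfb h hnN hp ⟨l, Nat.lt_succ_iff.2 hl⟩
    rwa [WGeom.sum_laxZbar_smul p _ fun m => WGeom.u f fb m x] at this
  · have := WGeom.hasLineDerivAt_ub_of_u hf hfb h hnN _ _
      (WGeom.hasLineDerivAt_u_bar hf hfb h hnN hp) ⟨l, Nat.lt_succ_iff.2 hl⟩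
    rwa [WGeom.sum_laxZbar_smul_col p _ fun m => WGeom.ub f fb m x] at this
  · have := WGeom.hasLineDerivAt_ub_of_u hf hfb h hnN _ _
      (WGeom.hasLineDerivAt_u hf hfb h hnN hp) ⟨l, Nat.lt_succ_iff.2 hl⟩
    rwa [WGeom.sum_laxZ_smul_col p _ fun m => WGeom.ub f fb m x] at this
  · exact WGeom.zakharovShabat_of_frame hf hfb h hnN _ _ (WGeom.contDiffAt_laxZ hf hfb h p)
      (WGeom.contDiffAt_laxZbar hf hfb h q)
      (fun y hy => WGeom.hasLineDerivAt_u hf hfb hy hnN hp)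
      (fun y hy => WGeom.hasLineDerivAt_u_bar hf hfb hy hnN hq)
  · exact WGeom.zakharovShabat_of_frame hf hfb h hnN _ _ (WGeom.contDiffAt_laxZ hf hfb h p)
      (WGeom.contDiffAt_laxZ hf hfb h q)
      (fun y hy => WGeom.hasLineDerivAt_u hf hfb hy hnN hp)
      (fun y hy => WGeom.hasLineDerivAt_u hf hfb hy hnN hq)
  · exact WGeom.zakharovShabat_of_frame hf hfb h hnN _ _ (WGeom.contDiffAt_laxZbar hf hfb h p)
      (WGeom.contDiffAt_laxZbar hf hfb h q)
      (fun y hy => WGeom.hasLineDerivAt_u_bar hf hfb hy hnN hp)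
      (fun y hy => WGeom.hasLineDerivAt_u_bar hf hfb hy hnN hq)
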